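/- Let $N\ge 1$ and let $\Omega\subset\mathbb{R}^N$ be a bounded smooth domain, i.e. a nonempty connected bounded open set with $C^\infty$ boundary (near each boundary point, in suitable Cartesian coordinates, $\Omega$ is the region above the graph of a $C^\infty$ function). Every $u\in H^1(\Omega)$ has a boundary trace in $L^2(\partial\Omega,\mathcal{H}^{N-1})$, i.e. a function $g\in L^2(\partial\Omega,\mathcal{H}^{N-1})$ for which there are functions $\varphi_k\in C^\infty(\mathbb{R}^N)$ with $\varphi_k\to u$ in $H^1(\Omega)$ and $\varphi_k|_{\partial\Omega}\to g$ in $L^2(\partial\Omega,\mathcal{H}^{N-1})$; the values of $u$ on $\partial\Omega$ are understood in this sense. There is a constant $c_\Omega>0$ such that for every $u\in H^1(\Omega)$ and every $\delta>0$, $$\delta\,(c_\Omega-\delta)\int_\Omega u^2(x)\,\mathrm{d}x\;\le\;\int_\Omega|\nabla u(x)|^2\,\mathrm{d}x+\delta\int_{\partial\Omega}u^2(x)\,\mathrm{d}\mathcal{H}^{N-1}(x).$$ Moreover, one can take $c_\Omega=\dfrac{N}{\operatorname{diam}(\Omega)}$. -/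

import Mathlib

open MeasureTheory Set Filter Topology
open scoped ContDiff ENNReal

/-- `ℝ^N` with its Euclidean norm, inner product and Lebesgue measure. -/
abbrev RN (N : ℕ) : Type := EuclideanSpace ℝ (Fin N)

/-- `Ω ⊂ ℝ^N` is a bounded smooth domain: a nonempty connected bounded open set which, near each
of its boundary points `x`, is the region strictly above the graph of a `C^∞` function, in some
direction. Here `e` is the unit vector that points upwards, `⟪e, y⟫` is the height of the point `y`,
and `y - ⟪e, y⟫ e` is its orthogonal projection to the hyperplane `e^⊥`, the only part of `y` on
which the graph function `γ` is evaluated. -/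
structure IsBoundedSmoothDomain {N : ℕ} (Ω : Set (RN N)) : Prop where
  isOpen : IsOpen Ω
  isConnected : IsConnected Ω
  isBounded : Bornology.IsBounded Ω
  smooth_boundary : ∀ x ∈ frontier Ω, ∃ r : ℝ, 0 < r ∧ ∃ e : RN N, ‖e‖ = 1 ∧
    ∃ γ : RN N → ℝ, ContDiff ℝ ∞ γ ∧
      Ω ∩ Metric.ball x r =
        {y | γ (y - (inner ℝ e y : ℝ) • e) < (inner ℝ e y : ℝ)} ∩ Metric.ball x r

/-- The Lebesgue measure on `Ω`. -/
noncomputable def volumeOn {N : ℕ} (Ω : Set (RN N)) : Measure (RN N) :=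
  (volume : Measure (RN N)).restrict Ω

/-- The surface measure on `∂Ω`: the `(N-1)`-dimensional Hausdorff measure `𝓗^{N-1}`, in its usual
normalization (`𝓗^d` is the Lebesgue measure on `ℝ^d`), restricted to the boundary of `Ω`. For
`N = 1` it is the counting measure on `∂Ω`. -/
noncomputable def surfaceMeasure {N : ℕ} (Ω : Set (RN N)) : Measure (RN N) :=
  (Measure.euclideanHausdorffMeasure (N - 1) : Measure (RN N)).restrict (frontier Ω)

/-- `u ∈ H^1(Ω)`, with weak gradient `G`: both lie in `L^2(Ω)`, and
`∫_Ω u ∂_i ψ = - ∫_Ω G_i ψ` for all test functions `ψ ∈ C_c^∞(Ω)` and all `i`. -/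
structure IsH1WithGradient {N : ℕ} (Ω : Set (RN N)) (u : RN N → ℝ) (G : RN N → RN N) : Prop where
  memLp : MemLp u 2 (volumeOn Ω)
  memLp_gradient : MemLp G 2 (volumeOn Ω)
  weak_gradient : ∀ ψ : RN N → ℝ, ContDiff ℝ ∞ ψ → HasCompactSupport ψ → tsupport ψ ⊆ Ω →
    ∀ i : Fin N,
      ∫ x, u x * fderiv ℝ ψ x (EuclideanSpace.single i 1) ∂(volumeOn Ω) =
        - ∫ x, G x i * ψ x ∂(volumeOn Ω)

/-- `g ∈ L^2(∂Ω)` is the boundary trace of `u ∈ H^1(Ω)`. The trace operator is the continuous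
extension to `H^1(Ω)`, with values in `L^2(∂Ω)`, of the restriction `φ ↦ φ|_∂Ω` of functions `φ`
that are smooth up to the boundary. So `g` is the limit in `L^2(∂Ω)` of `φ_k|_∂Ω` for smooth
functions `φ_k` with `φ_k → u` in `H^1(Ω)`. -/
def IsTrace {N : ℕ} (Ω : Set (RN N)) (u : RN N → ℝ) (g : RN N → ℝ) : Prop :=
  MemLp g 2 (surfaceMeasure Ω) ∧
    ∃ G : RN N → RN N, IsH1WithGradient Ω u G ∧
      ∃ φ : ℕ → RN N → ℝ, (∀ k, ContDiff ℝ ∞ (φ k)) ∧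
        Tendsto (fun k => eLpNorm (fun x => φ k x - u x) 2 (volumeOn Ω)) atTop (𝓝 0) ∧
        Tendsto (fun k => eLpNorm (fun x => gradient (φ k) x - G x) 2 (volumeOn Ω))
          atTop (𝓝 0) ∧
        Tendsto (fun k => eLpNorm (fun x => φ k x - g x) 2 (surfaceMeasure Ω)) atTop (𝓝 0)

/-- The Poincaré-type inequality on `Ω` with constant `c`, for all `u ∈ H^1(Ω)` (with weak gradient
`G` and boundary trace `g`) and all `δ > 0`. -/
def PoincareTypeInequality {N : ℕ} (Ω : Set (RN N)) (c : ℝ) : Prop :=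
  ∀ (u : RN N → ℝ) (G : RN N → RN N) (g : RN N → ℝ),
    IsH1WithGradient Ω u G → IsTrace Ω u g →
    ∀ δ : ℝ, 0 < δ →
      δ * (c - δ) * ∫ x, u x ^ 2 ∂(volumeOn Ω) ≤
        ∫ x, ‖G x‖ ^ 2 ∂(volumeOn Ω) + δ * ∫ x, g x ^ 2 ∂(surfaceMeasure Ω)

/-!
The inequality comes from the divergence theorem for the field `u^2 (z - x₀)` with `x₀ ∈ Ω`. Its
divergence is `N u^2 + 2 u ∇u · (z - x₀)` and `|z - x₀| ≤ d = diam Ω`, so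
`N ∫_Ω u^2 ≤ d ∫_∂Ω u^2 + 2 d ∫_Ω |u| |∇u|`, and `2 |u| |∇u| ≤ δ u^2 + |∇u|^2 / δ` gives the claim
after multiplication by `δ / d`. This is carried out for functions that are smooth up to the boundary
(`IsBoundedSmoothDomain.integral_div_le`, `IsBoundedSmoothDomain.poincare_of_contDiff`) and extends
to `H^1(Ω)` by density, since weak gradients are unique.

The divergence theorem is proved by means of a smooth partition of unity in charts in which `Ω` is
the region above a graph. There it is Fubini in sheared coordinates
(`integral_fderiv_above_graph`), which gives the flux as an integral over the hyperplane below the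
graph. Only an upper bound for the flux by the integral over `∂Ω` is needed, and therefore only one
half of the area formula: the Hausdorff measure of a piece of the graph of `g` is at least
`∫ √(1 + |∇g|^2)` (`withDensity_le_comap_graphMap`). This half is local: near each point the graph
parametrization is nearly its differential `A`, so `A` composed with the inverse of the
parametrization has a Lipschitz constant close to `1`, and `A` scales volumes by
`√(1 + |∇g|^2)`. In the other direction a Lipschitz bound suffices; it yields the trace inequality
`∫_∂Ω φ^2 ≤ C ∫_Ω (φ^2 + |∇φ|^2)` (`IsBoundedSmoothDomain.exists_trace_inequality`).

Traces exist because functions that are smooth on `ℝ^N` are dense in `H^1(Ω)`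
(`IsH1WithGradient.exists_approx`) and the trace inequality turns an approximating sequence into a
Cauchy sequence in `L^2(∂Ω)`. For the density, the piece of `u` in each chart is extended by zero and
convolved with bump functions whose supports lie off the origin, so that the convolution at a point
of `Ω` only sees values of `u` further up, inside `Ω`.
-/

/-! ### Surface area of graphs -/

/-- The parametrization `y ↦ y + g y • e` of the graph of a function `g` on the hyperplane `e^⊥`,
as a subset of `ℝ^N`. -/
noncomputable def graphMap {N : ℕ} (e : RN N) (g : (ℝ ∙ e)ᗮ → ℝ) (y : (ℝ ∙ e)ᗮ) : RN N :=
  (y : RN N) + g y • e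

section Graph

variable {N : ℕ} {e : RN N} {g : (ℝ ∙ e)ᗮ → ℝ}

lemma inner_coe_orthogonal (y : (ℝ ∙ e)ᗮ) : inner ℝ e (y : RN N) = 0 :=
  Submodule.mem_orthogonal_singleton_iff_inner_right.1 y.2

lemma inner_add_smul (he : ‖e‖ = 1) (y : (ℝ ∙ e)ᗮ) (t : ℝ) :
    inner ℝ e ((y : RN N) + t • e) = t := by
  rw [inner_add_right, inner_coe_orthogonal, inner_smul_right, real_inner_self_eq_norm_sq, he]
  simp

lemma norm_add_smul_sq (he : ‖e‖ = 1) (y : (ℝ ∙ e)ᗮ) (t : ℝ) :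
    ‖(y : RN N) + t • e‖ ^ 2 = ‖y‖ ^ 2 + t ^ 2 := by
  have h : inner ℝ (y : RN N) (t • e) = 0 := by
    rw [inner_smul_right, real_inner_comm, inner_coe_orthogonal, mul_zero]
  have := norm_add_sq_eq_norm_sq_add_norm_sq_of_inner_eq_zero _ _ h
  rw [norm_smul, he, mul_one] at this
  simpa [sq] using this

lemma orthogonalProjectionOnto_add_smul (y : (ℝ ∙ e)ᗮ) (t : ℝ) :
    (ℝ ∙ e)ᗮ.orthogonalProjectionOnto ((y : RN N) + t • e) = y := by
  have h : t • e ∈ (ℝ ∙ e)ᗮᗮ :=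
    Submodule.le_orthogonal_orthogonal _ (Submodule.smul_mem _ _
      (Submodule.mem_span_singleton_self e))
  rw [map_add, Submodule.orthogonalProjectionOnto_mem_subspace_eq_self,
    Submodule.orthogonalProjectionOnto_apply_of_mem_orthogonal h, add_zero]

lemma coe_orthogonalProjectionOnto (he : ‖e‖ = 1) (x : RN N) :
    ((ℝ ∙ e)ᗮ.orthogonalProjectionOnto x : RN N) = x - (inner ℝ e x : ℝ) • e := by
  have hmem : x - (inner ℝ e x : ℝ) • e ∈ (ℝ ∙ e)ᗮ := by
    rw [Submodule.mem_orthogonal_singleton_iff_inner_right, inner_sub_right, inner_smul_right,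
      real_inner_self_eq_norm_sq, he]
    ring
  have := orthogonalProjectionOnto_add_smul (e := e) ⟨_, hmem⟩ (inner ℝ e x)
  rw [sub_add_cancel] at this
  rw [this]

lemma finrank_orthogonal_unit (he : ‖e‖ = 1) : Module.finrank ℝ (ℝ ∙ e)ᗮ = N - 1 := by
  have h0 : e ≠ 0 := by rintro rfl; simp at he
  have h1 := Submodule.finrank_add_finrank_orthogonal (ℝ ∙ e)
  rw [finrank_span_singleton h0, finrank_euclideanSpace_fin] at h1
  omega

lemma continuous_graphMap (hg : Continuous g) : Continuous (graphMap e g) := by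
  unfold graphMap; fun_prop

lemma isClosedEmbedding_graphMap (hg : Continuous g) :
    IsClosedEmbedding (graphMap e g) := by
  refine Function.LeftInverse.isClosedEmbedding
    (f := fun x => (ℝ ∙ e)ᗮ.orthogonalProjectionOnto x) (fun y => ?_) (by fun_prop)
    (continuous_graphMap hg)
  exact orthogonalProjectionOnto_add_smul y _

/-- The differential of `graphMap e g` at a point where `g` has differential `l`. -/
noncomputable def graphDeriv (e : RN N) (l : (ℝ ∙ e)ᗮ →L[ℝ] ℝ) : (ℝ ∙ e)ᗮ →L[ℝ] RN N :=
  (ℝ ∙ e)ᗮ.subtypeL + l.smulRight e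

lemma graphDeriv_apply (l : (ℝ ∙ e)ᗮ →L[ℝ] ℝ) (y : (ℝ ∙ e)ᗮ) :
    graphDeriv e l y = (y : RN N) + l y • e := rfl

lemma norm_le_norm_graphDeriv (he : ‖e‖ = 1) (l : (ℝ ∙ e)ᗮ →L[ℝ] ℝ) (y : (ℝ ∙ e)ᗮ) :
    ‖y‖ ≤ ‖graphDeriv e l y‖ := by
  rw [graphDeriv_apply]
  refine le_of_sq_le_sq ?_ (norm_nonneg _) 
  rw [norm_add_smul_sq he]
  nlinarith [sq_nonneg (l y)]

/-- The Gram determinant of `y ↦ y + l y • e` is that of a rank one perturbation of the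
identity. -/
lemma normDet_graphDeriv (he : ‖e‖ = 1) (l : (ℝ ∙ e)ᗮ →L[ℝ] ℝ) :
    (graphDeriv e l : (ℝ ∙ e)ᗮ →ₗ[ℝ] RN N).normDet = √(1 + ‖l‖ ^ 2) := by
  set b := stdOrthonormalBasis ℝ (ℝ ∙ e)ᗮ
  have h := LinearMap.normDet_sq_eq_det_gram (graphDeriv e l : (ℝ ∙ e)ᗮ →ₗ[ℝ] RN N) b
  have hgram : Matrix.gram ℝ (fun i => (graphDeriv e l : (ℝ ∙ e)ᗮ →ₗ[ℝ] RN N) (b i)) =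
      1 + Matrix.replicateCol Unit (fun i => l (b i)) *
        Matrix.replicateRow Unit (fun i => l (b i)) := by
    ext i j
    simp only [Matrix.gram_apply, ContinuousLinearMap.coe_coe, graphDeriv_apply, Matrix.add_apply,
      Matrix.mul_apply, Matrix.replicateCol_apply, Matrix.replicateRow_apply, Finset.univ_unique,
      Finset.sum_const, Finset.card_singleton, one_smul]
    rw [inner_add_left, inner_add_right, inner_add_right, inner_smul_left, inner_smul_right,
      inner_smul_right, inner_smul_left, inner_coe_orthogonal, real_inner_comm e (b i : RN N),
      inner_coe_orthogonal, real_inner_self_eq_norm_sq, he]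
    have := orthonormal_iff_ite.1 b.orthonormal i j
    rw [Submodule.coe_inner] at this
    rw [this, Matrix.one_apply]
    simp [mul_comm]
  have hl : ‖l‖ ^ 2 = ∑ i, l (b i) * l (b i) := by
    have h1 := b.sum_sq_norm_inner_right ((InnerProductSpace.toDual ℝ _).symm l)
    rw [LinearIsometryEquiv.norm_map] at h1
    rw [← h1]
    refine Finset.sum_congr rfl fun i _ => ?_
    rw [real_inner_comm, InnerProductSpace.toDual_symm_apply, Real.norm_eq_abs, sq_abs, sq]
  rw [hgram, Matrix.det_one_add_replicateCol_mul_replicateRow] at h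
  rw [hl, ← Real.sqrt_sq (LinearMap.normDet_nonneg _)]
  congr 1

lemma hasStrictFDerivAt_graphMap (hg : ContDiff ℝ 1 g) (y : (ℝ ∙ e)ᗮ) :
    HasStrictFDerivAt (graphMap e g) (graphDeriv e (fderiv ℝ g y)) y := by
  have h1 := (hg.contDiffAt (x := y)).hasStrictFDerivAt one_ne_zero
  exact ((ℝ ∙ e)ᗮ.subtypeL.hasStrictFDerivAt).add (h1.smul_const e)

end Graph

/-- A measure that is locally smaller than another one is smaller. -/
lemma measure_le_of_forall_nhds {X : Type*} [TopologicalSpace X] [SecondCountableTopology X]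
    [MeasurableSpace X] [OpensMeasurableSpace X] {μ ν : Measure X}
    (h : ∀ x, ∃ u ∈ 𝓝 x, ∀ s ⊆ u, MeasurableSet s → μ s ≤ ν s) : μ ≤ ν := by
  choose u hu hs using h
  obtain ⟨c, hc, hcu⟩ := TopologicalSpace.countable_cover_nhds (f := fun x => interior (u x))
    (fun x => interior_mem_nhds.2 (hu x))
  rcases c.eq_empty_or_nonempty with rfl | hne
  · have : IsEmpty X := by
      refine ⟨fun x => ?_⟩
      have : x ∈ (univ : Set X) := mem_univ x
      rw [← hcu] at this
      simp at this
    refine Measure.le_iff.2 fun s _ => ?_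
    simp [Set.eq_empty_of_isEmpty s]
  obtain ⟨f, rfl⟩ := hc.exists_eq_range hne
  rw [biUnion_range] at hcu
  refine Measure.le_iff.2 fun s hsm => ?_
  set d := disjointed fun n => interior (u (f n))
  have hd : ∀ n, MeasurableSet (d n) :=
    MeasurableSet.disjointed fun n => isOpen_interior.measurableSet
  have hdU : ⋃ n, d n = univ := by rw [iUnion_disjointed, hcu]
  have hsd : s = ⋃ n, s ∩ d n := by rw [← inter_iUnion, hdU, inter_univ]
  have hdisj : Pairwise (Function.onFun Disjoint fun n => s ∩ d n) := fun i j hij =>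
    (disjoint_disjointed _ hij).mono inter_subset_right inter_subset_right
  rw [hsd, measure_iUnion hdisj fun n => hsm.inter (hd n),
    measure_iUnion hdisj fun n => hsm.inter (hd n)]
  exact ENNReal.tsum_le_tsum fun n => hs (f n) _ (inter_subset_right.trans
    ((disjointed_subset _ n).trans interior_subset)) (hsm.inter (hd n))

section Area

variable {N : ℕ} {e : RN N} {g : (ℝ ∙ e)ᗮ → ℝ}

/-- Where a map `f` is within relative error `1 - 1 / K` of an injective linear map `A`, it
contracts `d`-dimensional volume by at most `K ^ d` more than `A` does. -/
lemma normDet_mul_volume_le {U V : Type*} [NormedAddCommGroup U] [InnerProductSpace ℝ U]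
    [FiniteDimensional ℝ U] [MeasurableSpace U] [BorelSpace U]
    [NormedAddCommGroup V] [InnerProductSpace ℝ V] [MeasurableSpace V] [BorelSpace V]
    {f : U → V} {A : U →L[ℝ] V} (hA : ∀ y, ‖y‖ ≤ ‖A y‖) {K c : NNReal} (hK : 1 ≤ K)
    (hc : (c : ℝ) = 1 - (K : ℝ)⁻¹) {s : Set U} (hf : ApproximatesLinearOn f A s c) :
    ENNReal.ofReal (A : U →ₗ[ℝ] V).normDet * volume s ≤
      (K : ℝ≥0∞) ^ Module.finrank ℝ U *
        Measure.euclideanHausdorffMeasure (Module.finrank ℝ U) (f '' s) := by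
  have hK0 : (0 : ℝ) < K := zero_lt_one.trans_le hK
  have hexp : ∀ y ∈ s, ∀ z ∈ s, ‖A (y - z)‖ ≤ K * ‖f y - f z‖ := by
    intro y hy z hz
    have h1 := hf y hy z hz
    have h2 : ‖A (y - z)‖ ≤ ‖f y - f z‖ + ‖f y - f z - A (y - z)‖ := by
      have := norm_sub_le (f y - f z) (f y - f z - A (y - z))
      simpa using this
    have h3 : (c : ℝ) * ‖y - z‖ ≤ c * ‖A (y - z)‖ :=
      mul_le_mul_of_nonneg_left (hA _) c.2
    have h4 : (K : ℝ)⁻¹ * ‖A (y - z)‖ ≤ ‖f y - f z‖ := by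
      rw [hc] at h3 h1
      linarith
    calc ‖A (y - z)‖ = K * ((K : ℝ)⁻¹ * ‖A (y - z)‖) := by field_simp
      _ ≤ _ := mul_le_mul_of_nonneg_left h4 hK0.le
  have hinj : InjOn f s := by
    intro y hy z hz hyz
    have := hexp y hy z hz
    rw [hyz, sub_self, norm_zero, mul_zero] at this
    have := (hA _).trans this
    exact sub_eq_zero.1 (norm_le_zero_iff.1 this)
  have hlip : LipschitzOnWith K (fun z => A (Function.invFunOn f s z)) (f '' s) := by
    refine LipschitzOnWith.of_dist_le_mul ?_
    rintro _ ⟨y, hy, rfl⟩ _ ⟨z, hz, rfl⟩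
    rw [hinj.leftInvOn_invFunOn hy, hinj.leftInvOn_invFunOn hz, dist_eq_norm, dist_eq_norm,
      ← map_sub]
    exact hexp y hy z hz
  have himg : (fun z => A (Function.invFunOn f s z)) '' (f '' s) = A '' s := by
    rw [image_image]
    exact image_congr fun y hy => by rw [hinj.leftInvOn_invFunOn hy]
  have h := hlip.hausdorffMeasure_image_le (d := Module.finrank ℝ U) (by positivity)
  rw [himg] at h
  have h2 := LinearMap.euclideanHausdorffMeasure_image_eq_normDet_mul_volume
    (A : U →ₗ[ℝ] V) s
  rw [← h2, Measure.euclideanHausdorffMeasure_def, Measure.smul_apply, Measure.smul_apply,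
    ENNReal.smul_def, ENNReal.smul_def, smul_eq_mul, smul_eq_mul, mul_left_comm]
  rw [ENNReal.rpow_natCast] at h
  exact mul_le_mul_right h _

/-- The lower bound in the area formula for graphs: the area of a piece of the graph of a `C^1`
function `g` is at least `∫ √(1 + |∇g|^2)`. -/
lemma withDensity_le_comap_graphMap (he : ‖e‖ = 1) (hg : ContDiff ℝ 1 g) :
    (volume : Measure (ℝ ∙ e)ᗮ).withDensity (fun y => ENNReal.ofReal √(1 + ‖fderiv ℝ g y‖ ^ 2)) ≤
      (Measure.euclideanHausdorffMeasure (N - 1) : Measure (RN N)).comap (graphMap e g) := by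
  set ρ := (volume : Measure (ℝ ∙ e)ᗮ).withDensity
    (fun y => ENNReal.ofReal √(1 + ‖fderiv ℝ g y‖ ^ 2))
  set ν := (Measure.euclideanHausdorffMeasure (N - 1) : Measure (RN N)).comap (graphMap e g)
  have hemb := (isClosedEmbedding_graphMap hg.continuous).measurableEmbedding
  have hcont : Continuous fun y => √(1 + ‖fderiv ℝ g y‖ ^ 2) := by
    have := hg.continuous_fderiv one_ne_zero
    exact (continuous_const.add (this.norm.pow 2)).sqrt
  have key : ∀ K : NNReal, 1 < K → ρ ≤ (K * (K : ℝ≥0∞) ^ (N - 1)) • ν := by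
    intro K hK
    have hK1 : (1 : ℝ) < K := hK
    refine measure_le_of_forall_nhds fun y₀ => ?_
    set w₀ := √(1 + ‖fderiv ℝ g y₀‖ ^ 2)
    have hw₀ : 0 < w₀ := by positivity
    have hcpos : 0 < 1 - (K : ℝ)⁻¹ := by
      have := inv_lt_one_of_one_lt₀ hK1
      linarith
    obtain ⟨u, hu, hlin⟩ := (hasStrictFDerivAt_graphMap hg y₀).approximates_deriv_on_nhds
      (c := ⟨1 - (K : ℝ)⁻¹, hcpos.le⟩) (Or.inr hcpos)
    have hv : {y | √(1 + ‖fderiv ℝ g y‖ ^ 2) < K * w₀} ∈ 𝓝 y₀ :=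
      (isOpen_lt hcont continuous_const).mem_nhds (by
        change w₀ < K * w₀
        nlinarith)
    refine ⟨_, inter_mem hu hv, fun s hs hsm => ?_⟩
    have h1 : ρ s ≤ ENNReal.ofReal (K * w₀) * volume s := by
      rw [withDensity_apply _ hsm, ← setLIntegral_const]
      refine setLIntegral_mono' hsm fun y hy => ENNReal.ofReal_le_ofReal ?_
      exact (show _ < _ from (hs hy).2).le
    have h2 := normDet_mul_volume_le (norm_le_norm_graphDeriv he _) hK.le rfl
      (hlin.mono_set (hs.trans inter_subset_left))
    rw [normDet_graphDeriv he, finrank_orthogonal_unit he] at h2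
    calc ρ s ≤ K * (ENNReal.ofReal w₀ * volume s) := by
          rwa [ENNReal.ofReal_mul K.coe_nonneg, ENNReal.ofReal_coe_nnreal, mul_assoc] at h1
      _ ≤ K * (K ^ (N - 1) * _) := mul_le_mul_right h2 _
      _ = _ := by
          rw [Measure.smul_apply, smul_eq_mul, hemb.comap_apply, mul_assoc]
  refine Measure.le_iff.2 fun s _ => ?_
  have hlim : Tendsto (fun K : NNReal => ((K : ℝ≥0∞) * (K : ℝ≥0∞) ^ (N - 1)) * ν s) (𝓝[>] 1)
      (𝓝 (1 * ν s)) := by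
    refine ENNReal.Tendsto.mul_const ?_ (Or.inl one_ne_zero)
    have h0 : Continuous fun K : NNReal => (((K * K ^ (N - 1) : NNReal)) : ℝ≥0∞) := by fun_prop
    have := (h0.tendsto 1).mono_left (nhdsWithin_le_nhds (s := Ioi 1))
    simpa using this
  rw [one_mul] at hlim
  refine ge_of_tendsto hlim ?_
  filter_upwards [self_mem_nhdsWithin] with K hK
  exact key K hK s

/-- The area of the part of the graph of a `C^1` function that lies over a bounded set is at most
a constant times the volume of that set. -/
lemma exists_comap_graphMap_le (he : ‖e‖ = 1) (hg : ContDiff ℝ 1 g) (R : ℝ) :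
    ∃ C : NNReal, ((Measure.euclideanHausdorffMeasure (N - 1) : Measure (RN N)).comap
      (graphMap e g)).restrict (Metric.closedBall 0 R) ≤
        C • (volume : Measure (ℝ ∙ e)ᗮ) := by
  have hemb := (isClosedEmbedding_graphMap hg.continuous).measurableEmbedding
  have hΓ : ContDiff ℝ 1 (graphMap e g) :=
    ((ℝ ∙ e)ᗮ.subtypeL.contDiff).add (hg.smul contDiff_const)
  obtain ⟨L, hL⟩ := hΓ.contDiffOn.exists_lipschitzOnWith (s := Metric.closedBall 0 R) one_ne_zero
    (convex_closedBall _ _) (isCompact_closedBall _ _)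
  refine ⟨L ^ (N - 1), Measure.le_iff.2 fun s hs => ?_⟩
  rw [Measure.restrict_apply hs, hemb.comap_apply]
  have h := (hL.mono inter_subset_right).hausdorffMeasure_image_le (s := s ∩ Metric.closedBall 0 R)
    (d := (N - 1 : ℕ)) (by positivity)
  have hvol := InnerProductSpace.euclideanHausdorffMeasure_eq_volume (V := (ℝ ∙ e)ᗮ)
  rw [finrank_orthogonal_unit he] at hvol
  rw [← hvol, Measure.smul_apply, Measure.euclideanHausdorffMeasure_def,
    Measure.euclideanHausdorffMeasure_def, Measure.smul_apply, Measure.smul_apply]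
  simp only [ENNReal.smul_def, smul_eq_mul]
  rw [ENNReal.rpow_natCast] at h
  rw [mul_left_comm, ENNReal.coe_pow]
  refine mul_le_mul_right (h.trans ?_) _
  exact mul_le_mul_right (measure_mono inter_subset_left) _

end Area

/-! ### Boundary charts -/

/-- In the ball of radius `r` around `x`, the set `Ω` is the region above the graph of the smooth
function `γ` on `e^⊥`, the unit vector `e` pointing upwards. The centre `x` need not lie on the
boundary of `Ω`: if the graph stays below the ball, the ball lies in `Ω`. -/
structure IsGraphChart {N : ℕ} (Ω : Set (RN N)) (x : RN N) (r : ℝ) (e : RN N) (γ : RN N → ℝ) :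
    Prop where
  r_pos : 0 < r
  norm_eq : ‖e‖ = 1
  contDiff : ContDiff ℝ ∞ γ
  inter_ball : Ω ∩ Metric.ball x r =
    {y | γ (y - (inner ℝ e y : ℝ) • e) < (inner ℝ e y : ℝ)} ∩ Metric.ball x r

lemma IsBoundedSmoothDomain.exists_isGraphChart {N : ℕ} (hN : 1 ≤ N) {Ω : Set (RN N)}
    (hΩ : IsBoundedSmoothDomain Ω) {x : RN N} (hx : x ∈ closure Ω) :
    ∃ r e γ, IsGraphChart Ω x r e γ := by
  by_cases hxΩ : x ∈ Ω
  · obtain ⟨r, hr, hball⟩ := Metric.isOpen_iff.1 hΩ.isOpen x hxΩ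
    refine ⟨r, EuclideanSpace.single ⟨0, hN⟩ 1, fun _ => -(‖x‖ + r), hr, by simp,
      contDiff_const, ?_⟩
    -- a constant graph below the ball
    have hle : ∀ y ∈ Metric.ball x r,
        -(‖x‖ + r) < inner ℝ (EuclideanSpace.single (⟨0, hN⟩ : Fin N) (1 : ℝ)) y := by
      intro y hy
      have h1 := abs_real_inner_le_norm (EuclideanSpace.single (⟨0, hN⟩ : Fin N) (1 : ℝ)) y
      have h2 : ‖y‖ < ‖x‖ + r := by
        have := norm_sub_norm_le y x
        rw [mem_ball_iff_norm] at hy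
        linarith
      rw [PiLp.norm_single, norm_one, one_mul] at h1
      have := neg_abs_le (inner ℝ (EuclideanSpace.single (⟨0, hN⟩ : Fin N) (1 : ℝ)) y)
      linarith
    rw [inter_eq_right.2 hball, eq_comm, inter_eq_right]
    exact hle
  · have hfr : x ∈ frontier Ω := ⟨hx, by rwa [hΩ.isOpen.interior_eq]⟩
    obtain ⟨r, hr, e, he, γ, hγ, h⟩ := hΩ.smooth_boundary x hfr
    exact ⟨r, e, γ, hr, he, hγ, h⟩

namespace IsGraphChart

variable {N : ℕ} {Ω : Set (RN N)} {x : RN N} {r : ℝ} {e : RN N} {γ : RN N → ℝ}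

lemma contDiff_one (h : IsGraphChart Ω x r e γ) :
    ContDiff ℝ 1 fun y : (ℝ ∙ e)ᗮ => γ y :=
  (h.contDiff.of_le (by exact_mod_cast le_top)).comp (ℝ ∙ e)ᗮ.subtypeL.contDiff

lemma mem_iff (h : IsGraphChart Ω x r e γ) {z : RN N} (hz : z ∈ Metric.ball x r) :
    z ∈ Ω ↔ γ (z - (inner ℝ e z : ℝ) • e) < inner ℝ e z := by
  have := Set.ext_iff.1 h.inter_ball z
  exact ⟨fun hzΩ => (this.1 ⟨hzΩ, hz⟩).1, fun hlt => (this.2 ⟨hlt, hz⟩).1⟩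

lemma add_smul_mem_iff (h : IsGraphChart Ω x r e γ) (y : (ℝ ∙ e)ᗮ) (t : ℝ)
    (hz : (y : RN N) + t • e ∈ Metric.ball x r) : (y : RN N) + t • e ∈ Ω ↔ γ y < t := by
  rw [h.mem_iff hz, inner_add_smul h.norm_eq, add_sub_cancel_right]

lemma frontier_inter_ball (hΩ : IsOpen Ω) (h : IsGraphChart Ω x r e γ) :
    frontier Ω ∩ Metric.ball x r =
      range (graphMap e fun y => γ y) ∩ Metric.ball x r := by
  have hcontγ : Continuous fun z : RN N => γ (z - (inner ℝ e z : ℝ) • e) :=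
    h.contDiff.continuous.comp (by fun_prop)
  have hcont : Continuous fun z : RN N => (inner ℝ e z : ℝ) := by fun_prop
  ext z
  refine and_congr_left fun hz => ⟨fun hfr => ?_, ?_⟩
  · rw [hΩ.frontier_eq] at hfr
    have h1 : inner ℝ e z ≤ γ (z - (inner ℝ e z : ℝ) • e) :=
      not_lt.1 fun hlt => hfr.2 ((h.mem_iff hz).2 hlt)
    have h2 : γ (z - (inner ℝ e z : ℝ) • e) ≤ inner ℝ e z := by
      by_contra hlt
      have hopen : {w | (inner ℝ e w : ℝ) < γ (w - (inner ℝ e w : ℝ) • e)} ∩ Metric.ball x r ∈ 𝓝 z :=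
        inter_mem ((isOpen_lt hcont hcontγ).mem_nhds (not_le.1 hlt))
          (Metric.isOpen_ball.mem_nhds hz)
      obtain ⟨w, hw, hwΩ⟩ := mem_closure_iff_nhds.1 hfr.1 _ hopen
      exact lt_asymm hw.1 ((h.mem_iff hw.2).1 hwΩ)
    refine ⟨(ℝ ∙ e)ᗮ.orthogonalProjectionOnto z, ?_⟩
    rw [graphMap, coe_orthogonalProjectionOnto h.norm_eq, le_antisymm h2 h1]
    simp
  · rintro ⟨y, rfl⟩
    rw [hΩ.frontier_eq]
    refine ⟨?_, fun hmem => lt_irrefl _ ((h.add_smul_mem_iff y _ hz).1 hmem)⟩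
    -- points slightly above the graph lie in `Ω`
    have hlim : Tendsto (fun t : ℝ => (y : RN N) + t • e) (𝓝[>] γ y)
        (𝓝 ((y : RN N) + γ y • e)) :=
      ((by fun_prop : Continuous fun t : ℝ => (y : RN N) + t • e).tendsto _).mono_left
        nhdsWithin_le_nhds
    refine mem_closure_of_tendsto hlim ?_
    filter_upwards [hlim.eventually (Metric.isOpen_ball.mem_nhds hz), self_mem_nhdsWithin]
      with t ht1 ht2
    exact (h.add_smul_mem_iff y t ht1).2 ht2

lemma lintegral_surfaceMeasure (hΩ : IsOpen Ω) (h : IsGraphChart Ω x r e γ)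
    {f : RN N → ℝ≥0∞} (hfr : ∀ z ∉ Metric.ball x r, f z = 0) :
    ∫⁻ z, f z ∂(surfaceMeasure Ω) =
      ∫⁻ y, f (graphMap e (fun y => γ y) y)
        ∂((Measure.euclideanHausdorffMeasure (N - 1) : Measure (RN N)).comap
          (graphMap e fun y => γ y)) := by
  have hemb := (isClosedEmbedding_graphMap h.contDiff_one.continuous).measurableEmbedding
  rw [← hemb.lintegral_map, hemb.map_comap, surfaceMeasure]
  have hf : f = (Metric.ball x r).indicator f := by
    ext z
    by_cases hz : z ∈ Metric.ball x r
    · rw [indicator_of_mem hz]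
    · rw [indicator_of_notMem hz, hfr z hz]
  rw [hf, lintegral_indicator Metric.isOpen_ball.measurableSet,
    lintegral_indicator Metric.isOpen_ball.measurableSet,
    Measure.restrict_restrict Metric.isOpen_ball.measurableSet,
    Measure.restrict_restrict Metric.isOpen_ball.measurableSet, inter_comm, h.frontier_inter_ball hΩ,
    inter_comm]

/-- Integrals over the boundary dominate the integrals over the graph weighted with the area
density `√(1 + |∇γ|^2)`. -/
lemma lintegral_graphMap_le (hΩ : IsOpen Ω) (h : IsGraphChart Ω x r e γ)
    {f : RN N → ℝ≥0∞} (hf : Measurable f) (hfr : ∀ z ∉ Metric.ball x r, f z = 0) :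
    ∫⁻ y : (ℝ ∙ e)ᗮ, ENNReal.ofReal √(1 + ‖fderiv ℝ (fun y : (ℝ ∙ e)ᗮ => γ y) y‖ ^ 2) *
      f (graphMap e (fun y => γ y) y) ≤ ∫⁻ z, f z ∂(surfaceMeasure Ω) := by
  have hcont := h.contDiff_one.continuous_fderiv one_ne_zero
  have hmeas : Measurable fun y : (ℝ ∙ e)ᗮ =>
      ENNReal.ofReal √(1 + ‖fderiv ℝ (fun y : (ℝ ∙ e)ᗮ => γ y) y‖ ^ 2) :=
    (continuous_const.add (hcont.norm.pow 2)).sqrt.measurable.ennreal_ofReal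
  have hfΓ : Measurable fun y : (ℝ ∙ e)ᗮ => f (graphMap e (fun y => γ y) y) :=
    hf.comp (continuous_graphMap h.contDiff_one.continuous).measurable
  rw [h.lintegral_surfaceMeasure hΩ hfr]
  refine le_trans (le_of_eq ?_)
    (lintegral_mono' (withDensity_le_comap_graphMap h.norm_eq h.contDiff_one) le_rfl)
  rw [lintegral_withDensity_eq_lintegral_mul _ hmeas hfΓ]
  rfl

lemma exists_lintegral_surfaceMeasure_le (hΩ : IsOpen Ω) (h : IsGraphChart Ω x r e γ) :
    ∃ C : NNReal, ∀ f : RN N → ℝ≥0∞, (∀ z ∉ Metric.ball x r, f z = 0) →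
      ∫⁻ z, f z ∂(surfaceMeasure Ω) ≤
        C * ∫⁻ y : (ℝ ∙ e)ᗮ, f (graphMap e (fun y => γ y) y) := by
  obtain ⟨C, hC⟩ := exists_comap_graphMap_le h.norm_eq h.contDiff_one (‖x‖ + r)
  refine ⟨C, fun f hfr => ?_⟩
  rw [h.lintegral_surfaceMeasure hΩ hfr]
  have hsupp : Function.support (fun y : (ℝ ∙ e)ᗮ => f (graphMap e (fun y => γ y) y)) ⊆
      Metric.closedBall 0 (‖x‖ + r) := by
    intro y hy
    have hmem : graphMap e (fun y => γ y) y ∈ Metric.ball x r := by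
      by_contra hcon
      exact hy (hfr _ hcon)
    rw [mem_ball_iff_norm] at hmem
    have h1 := norm_sub_norm_le (graphMap e (fun y => γ y) y) x
    have h2 : ‖y‖ ≤ ‖graphMap e (fun y => γ y) y‖ := by
      refine le_of_sq_le_sq ?_ (norm_nonneg _)
      rw [graphMap, norm_add_smul_sq h.norm_eq]
      nlinarith [sq_nonneg (γ y)]
    rw [mem_closedBall_zero_iff]
    linarith
  rw [← setLIntegral_eq_of_support_subset hsupp]
  refine (lintegral_mono' hC le_rfl).trans (le_of_eq ?_)
  rw [lintegral_smul_measure]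
  rfl

end IsGraphChart

/-! ### The divergence theorem above a graph -/

/-- Coordinates adapted to the graph of `g`: the point at height `s` above the graph point
over `y`. -/
noncomputable def graphCoord {N : ℕ} (e : RN N) (g : (ℝ ∙ e)ᗮ → ℝ) (p : (ℝ ∙ e)ᗮ × ℝ) : RN N :=
  (p.1 : RN N) + (g p.1 + p.2) • e

section Flux

variable {N : ℕ} {e : RN N} {g : (ℝ ∙ e)ᗮ → ℝ}

lemma isClosedEmbedding_graphCoord (he : ‖e‖ = 1) (hg : Continuous g) :
    IsClosedEmbedding (graphCoord e g) := by
  refine Function.LeftInverse.isClosedEmbedding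
    (f := fun z => ((ℝ ∙ e)ᗮ.orthogonalProjectionOnto z,
      (inner ℝ e z : ℝ) - g ((ℝ ∙ e)ᗮ.orthogonalProjectionOnto z))) (fun p => ?_) (by fun_prop)
    (by unfold graphCoord; fun_prop)
  simp only [graphCoord]
  rw [orthogonalProjectionOnto_add_smul, inner_add_smul he]
  simp

/-- The coordinates are a shear followed by an isometry. -/
lemma measurePreserving_graphCoord (he : ‖e‖ = 1) (hg : Continuous g) :
    MeasurePreserving (graphCoord e g) := by
  have h1 : MeasurePreserving (fun p : (ℝ ∙ e)ᗮ × ℝ => (p.1, g p.1 + p.2)) :=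
    (MeasurePreserving.id (volume : Measure (ℝ ∙ e)ᗮ)).skew_product
      (g := fun y s => g y + s) (by fun_prop)
      (ae_of_all _ fun y => (measurePreserving_add_left volume (g y)).map_eq)
  have h2 : MeasurePreserving (fun p : (ℝ ∙ e)ᗮ × ℝ =>
      (LinearIsometryEquiv.toSpanUnitSingleton e he p.2, p.1)) :=
    ((LinearIsometryEquiv.toSpanUnitSingleton (𝕜 := ℝ) e he).measurePreserving.prod
      (MeasurePreserving.id (volume : Measure (ℝ ∙ e)ᗮ))).comp Measure.measurePreserving_swap
  have h3 := ((ℝ ∙ e).measurePreserving_measurableEquivProd (P := RN N) 0).symm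
  rw [InnerProductSpace.euclideanHausdorffMeasure_eq_volume] at h3
  have h := h3.comp (h2.comp h1)
  convert h using 1
  ext p : 1
  simp [graphCoord, add_comm]

lemma hasFDerivAt_graphCoord_left (hg : ContDiff ℝ 1 g) (y : (ℝ ∙ e)ᗮ) (s : ℝ) :
    HasFDerivAt (fun y => graphCoord e g (y, s)) (graphDeriv e (fderiv ℝ g y)) y := by
  have h1 := (hg.differentiable one_ne_zero y).hasFDerivAt
  exact ((ℝ ∙ e)ᗮ.subtypeL.hasFDerivAt).add ((h1.add_const s).smul_const e)

lemma hasDerivAt_graphCoord_right (y : (ℝ ∙ e)ᗮ) (s : ℝ) :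
    HasDerivAt (fun s => graphCoord e g (y, s)) e s := by
  have h1 : HasDerivAt (fun s => (g y + s) • e) ((1 : ℝ) • e) s :=
    ((hasDerivAt_id s).const_add (g y)).smul_const e
  rw [one_smul] at h1
  exact h1.const_add (y : RN N)

lemma contDiff_graphCoord (hg : ContDiff ℝ 1 g) : ContDiff ℝ 1 (graphCoord e g) :=
  ((ℝ ∙ e)ᗮ.subtypeL.contDiff.comp contDiff_fst).add
    (((hg.comp contDiff_fst).add contDiff_snd).smul contDiff_const)

/-- The divergence theorem above the graph of `g`, for the field `a v` with constant `v`: the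
outer normal is `(∇g, -1) / √(1 + |∇g|^2)` and the area element is `√(1 + |∇g|^2) dy`. -/
lemma integral_fderiv_above_graph (he : ‖e‖ = 1) (hg : ContDiff ℝ 1 g) {a : RN N → ℝ}
    (ha : ContDiff ℝ 1 a) (hac : HasCompactSupport a) (v : RN N) :
    ∫ z in {z | g ((ℝ ∙ e)ᗮ.orthogonalProjectionOnto z) < inner ℝ e z}, fderiv ℝ a z v =
      ∫ y, (fderiv ℝ g y ((ℝ ∙ e)ᗮ.orthogonalProjectionOnto v) - inner ℝ e v) *
        a (graphMap e g y) := by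
  set v' := (ℝ ∙ e)ᗮ.orthogonalProjectionOnto v
  have hemb := isClosedEmbedding_graphCoord he hg.continuous
  have hΦ := contDiff_graphCoord (e := e) hg
  have hpre : graphCoord e g ⁻¹' {z | g ((ℝ ∙ e)ᗮ.orthogonalProjectionOnto z) < inner ℝ e z} =
      univ ×ˢ Ioi 0 := by
    ext p
    simp only [mem_preimage, mem_ofPred_eq, graphCoord, mem_prod, mem_univ, true_and, mem_Ioi]
    rw [orthogonalProjectionOnto_add_smul, inner_add_smul he]
    simp
  rw [← (measurePreserving_graphCoord he hg.continuous).setIntegral_preimage_emb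
    hemb.measurableEmbedding, hpre]
  have hrestr : (volume : Measure ((ℝ ∙ e)ᗮ × ℝ)).restrict (univ ×ˢ Ioi 0) =
      (volume : Measure (ℝ ∙ e)ᗮ).prod (volume.restrict (Ioi 0)) := by
    rw [Measure.volume_eq_prod, ← Measure.prod_restrict, Measure.restrict_univ]
  have hDa := ha.continuous_fderiv one_ne_zero
  have hDg := hg.continuous_fderiv one_ne_zero
  have hDac : HasCompactSupport fun p => fderiv ℝ a (graphCoord e g p) :=
    (hac.fderiv ℝ).comp_isClosedEmbedding hemb
  have hDaΦ : Continuous fun p => fderiv ℝ a (graphCoord e g p) := hDa.comp hemb.continuous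
  -- the tangential and the vertical part of the derivative
  set A : (ℝ ∙ e)ᗮ × ℝ → ℝ := fun p =>
    fderiv ℝ a (graphCoord e g p) (graphDeriv e (fderiv ℝ g p.1) v')
  set B : (ℝ ∙ e)ᗮ × ℝ → ℝ := fun p =>
    (inner ℝ e v - fderiv ℝ g p.1 v') * fderiv ℝ a (graphCoord e g p) e
  have hA : Integrable A := by
    refine Continuous.integrable_of_hasCompactSupport ?_ (hDac.mono fun p hp h0 => hp ?_)
    · refine hDaΦ.clm_apply ?_
      simp only [graphDeriv_apply]
      fun_prop
    · simp [A, h0]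
  have hB : Integrable B := by
    refine Continuous.integrable_of_hasCompactSupport ?_ (hDac.mono fun p hp h0 => hp ?_)
    · fun_prop
    · simp [B, h0]
  have hsplit : ∀ p, fderiv ℝ a (graphCoord e g p) v = A p + B p := by
    intro p
    have hv : v = (v' : RN N) + (inner ℝ e v : ℝ) • e := by
      rw [coe_orthogonalProjectionOnto he, sub_add_cancel]
    conv_lhs => rw [hv]
    simp only [A, B, graphDeriv_apply, map_add, map_smul, smul_eq_mul]
    ring
  have hAr : Integrable A ((volume : Measure (ℝ ∙ e)ᗮ).prod (volume.restrict (Ioi 0))) := by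
    rw [← hrestr]; exact hA.restrict
  have hBr : Integrable B ((volume : Measure (ℝ ∙ e)ᗮ).prod (volume.restrict (Ioi 0))) := by
    rw [← hrestr]; exact hB.restrict
  rw [hrestr]
  simp only [hsplit]
  rw [integral_add hAr hBr, integral_prod_symm _ hAr, integral_prod _ hBr]
  have hA0 : ∀ s, ∫ y, A (y, s) = 0 := by
    intro s
    set b : (ℝ ∙ e)ᗮ → ℝ := fun y => a (graphCoord e g (y, s))
    have hemb' : IsClosedEmbedding fun y : (ℝ ∙ e)ᗮ => graphCoord e g (y, s) :=
      Function.LeftInverse.isClosedEmbedding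
        (f := fun z => (ℝ ∙ e)ᗮ.orthogonalProjectionOnto z)
        (fun y => orthogonalProjectionOnto_add_smul y _) (by fun_prop)
        (hemb.continuous.comp (by fun_prop))
    have hb : ContDiff ℝ 1 b := ha.comp (hΦ.comp (contDiff_id.prodMk contDiff_const))
    have hbc : HasCompactSupport b := hac.comp_isClosedEmbedding hemb'
    have hderiv : ∀ y, A (y, s) = fderiv ℝ b y v' := by
      intro y
      have h1 := (ha.differentiable one_ne_zero (graphCoord e g (y, s))).hasFDerivAt.comp y
        (hasFDerivAt_graphCoord_left hg y s)
      exact (congrArg (fun l => l v') h1.fderiv).symm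
    have hint : Integrable fun y => fderiv ℝ b y v' :=
      ((hb.continuous_fderiv one_ne_zero).clm_apply continuous_const).integrable_of_hasCompactSupport
        ((hbc.fderiv ℝ).mono fun y hy h0 => hy (by simp [h0]))
    have h := integral_mul_fderiv_eq_neg_fderiv_mul_of_integrable (μ := volume)
      (f := fun _ : (ℝ ∙ e)ᗮ => (1 : ℝ)) (g := b) (v := v') (by simp) (by simpa using hint)
      (by simpa using hb.continuous.integrable_of_hasCompactSupport hbc)
      (fun _ _ => differentiableAt_const _) (fun y _ => hb.differentiable one_ne_zero y)
    simpa [hderiv] using h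
  have hB0 : ∀ y, ∫ s in Ioi (0 : ℝ), B (y, s) =
      (fderiv ℝ g y v' - inner ℝ e v) * a (graphMap e g y) := by
    intro y
    set b : ℝ → ℝ := fun s => a (graphCoord e g (y, s))
    have hemb' : IsClosedEmbedding fun s : ℝ => graphCoord e g (y, s) :=
      Function.LeftInverse.isClosedEmbedding
        (f := fun z => (inner ℝ e z : ℝ) - g y)
        (fun s => by
          change inner ℝ e ((y : RN N) + (g y + s) • e) - g y = s
          rw [inner_add_smul he]; ring) (by fun_prop)
        (hemb.continuous.comp (by fun_prop))
    have hb : ContDiff ℝ 1 b := ha.comp (hΦ.comp (contDiff_const.prodMk contDiff_id))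
    have hbc : HasCompactSupport b := hac.comp_isClosedEmbedding hemb'
    have hderiv : ∀ s, fderiv ℝ a (graphCoord e g (y, s)) e = deriv b s := by
      intro s
      have h1 := (ha.differentiable one_ne_zero (graphCoord e g (y, s))).hasFDerivAt.comp_hasDerivAt s
        (hasDerivAt_graphCoord_right (g := g) y s)
      exact h1.deriv.symm
    simp only [B, hderiv]
    rw [integral_const_mul, hbc.integral_Ioi_deriv_eq hb]
    simp only [b, graphCoord, graphMap, add_zero]
    ring
  simp only [hA0, hB0, integral_zero, zero_add]

end Flux

/-! ### Divergence theorem and trace inequality on the domain -/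

lemma hasCompactSupport_of_tsupport_subset_ball {N : ℕ} {a : RN N → ℝ} {x : RN N} {r : ℝ}
    (h : tsupport a ⊆ Metric.ball x r) : HasCompactSupport a :=
  Metric.isCompact_of_isClosed_isBounded (isClosed_tsupport a) (Metric.isBounded_ball.subset h)

namespace IsGraphChart

variable {N : ℕ} {Ω : Set (RN N)} {x : RN N} {r : ℝ} {e : RN N} {γ : RN N → ℝ}

lemma setIntegral_fderiv (h : IsGraphChart Ω x r e γ) (hΩ : IsOpen Ω) {a : RN N → ℝ}
    (ha : ContDiff ℝ 1 a) (hsupp : tsupport a ⊆ Metric.ball x r) (v : RN N) :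
    ∫ z in Ω, fderiv ℝ a z v =
      ∫ y : (ℝ ∙ e)ᗮ, (fderiv ℝ (fun y : (ℝ ∙ e)ᗮ => γ y) y
        ((ℝ ∙ e)ᗮ.orthogonalProjectionOnto v) - inner ℝ e v) *
          a (graphMap e (fun y => γ y) y) := by
  rw [← integral_fderiv_above_graph h.norm_eq h.contDiff_one ha
    (hasCompactSupport_of_tsupport_subset_ball hsupp) v]
  have hzero : ∀ z ∉ Metric.ball x r, fderiv ℝ a z v = 0 := by
    intro z hz
    have : fderiv ℝ a z = 0 :=
      image_eq_zero_of_notMem_tsupport fun hmem => hz (hsupp (tsupport_fderiv_subset ℝ hmem))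
    rw [this]; rfl
  have hcont : Continuous fun z : RN N =>
      γ ((ℝ ∙ e)ᗮ.orthogonalProjectionOnto z : RN N) :=
    h.contDiff.continuous.comp (by fun_prop)
  have hmeas : MeasurableSet {z : RN N | γ ((ℝ ∙ e)ᗮ.orthogonalProjectionOnto z : RN N) <
      inner ℝ e z} := (isOpen_lt hcont (by fun_prop)).measurableSet
  rw [← integral_indicator hΩ.measurableSet, ← integral_indicator hmeas]
  congr 1
  ext z
  by_cases hz : z ∈ Metric.ball x r
  · have : z ∈ Ω ↔ z ∈ {z : RN N | γ ((ℝ ∙ e)ᗮ.orthogonalProjectionOnto z : RN N) <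
      inner ℝ e z} := by
      rw [h.mem_iff hz, mem_ofPred_eq, coe_orthogonalProjectionOnto h.norm_eq]
    by_cases hzΩ : z ∈ Ω
    · rw [indicator_of_mem hzΩ, indicator_of_mem (this.1 hzΩ)]
    · rw [indicator_of_notMem hzΩ, indicator_of_notMem fun hc => hzΩ (this.2 hc)]
  · have hzero' : ∀ s : Set (RN N), s.indicator (fun z => fderiv ℝ a z v) z = 0 := fun s =>
      indicator_apply_eq_zero.2 fun _ => hzero z hz
    rw [hzero', hzero']

/-- Local trace inequality: for nonnegative `a` supported in the chart, `∫_∂Ω a` is controlled by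
the derivative of `a` in the direction `e` transversal to the boundary. -/
lemma exists_lintegral_le_fderiv (h : IsGraphChart Ω x r e γ) (hΩ : IsOpen Ω) :
    ∃ C : NNReal, ∀ a : RN N → ℝ, ContDiff ℝ 1 a → tsupport a ⊆ Metric.ball x r →
      (∀ z, 0 ≤ a z) →
      ∫⁻ z, ENNReal.ofReal (a z) ∂(surfaceMeasure Ω) ≤
        C * ENNReal.ofReal (- ∫ z in Ω, fderiv ℝ a z e) := by
  obtain ⟨C, hC⟩ := h.exists_lintegral_surfaceMeasure_le hΩ
  refine ⟨C, fun a ha hsupp hnn => ?_⟩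
  have hac := hasCompactSupport_of_tsupport_subset_ball hsupp
  have hemb := isClosedEmbedding_graphMap (e := e) h.contDiff_one.continuous
  refine (hC (fun z => ENNReal.ofReal (a z)) fun z hz => ?_).trans (le_of_eq ?_)
  · rw [image_eq_zero_of_notMem_tsupport fun hmem => hz (hsupp hmem), ENNReal.ofReal_zero]
  · have hint : Integrable fun y : (ℝ ∙ e)ᗮ => a (graphMap e (fun y => γ y) y) :=
      (ha.continuous.comp hemb.continuous).integrable_of_hasCompactSupport
        (hac.comp_isClosedEmbedding hemb)
    rw [← ofReal_integral_eq_lintegral_ofReal hint (ae_of_all _ fun _ => hnn _),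
      h.setIntegral_fderiv hΩ ha hsupp, ← integral_neg]
    have hPe : (ℝ ∙ e)ᗮ.orthogonalProjectionOnto e = 0 := by
      ext1
      rw [coe_orthogonalProjectionOnto h.norm_eq, real_inner_self_eq_norm_sq, h.norm_eq]
      simp
    simp only [hPe, map_zero, real_inner_self_eq_norm_sq, h.norm_eq]
    simp

/-- The divergence theorem for the field `a(z) (z - x₀)` with `a` supported in the chart, whose
outward flux is at most `∫_∂Ω a |z - x₀|`. -/
lemma ofReal_integral_div_le (h : IsGraphChart Ω x r e γ) (hΩ : IsOpen Ω) {a : RN N → ℝ}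
    (ha : ContDiff ℝ 1 a) (hsupp : tsupport a ⊆ Metric.ball x r) (hnn : ∀ z, 0 ≤ a z)
    (x₀ : RN N) :
    ENNReal.ofReal (∫ z in Ω, (N * a z + fderiv ℝ a z (z - x₀))) ≤
      ∫⁻ z, ENNReal.ofReal (a z * ‖z - x₀‖) ∂(surfaceMeasure Ω) := by
  have hac := hasCompactSupport_of_tsupport_subset_ball hsupp
  set g : (ℝ ∙ e)ᗮ → ℝ := fun y => γ y
  have hg : ContDiff ℝ 1 g := h.contDiff_one
  have hDg := hg.continuous_fderiv one_ne_zero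
  have hemb := isClosedEmbedding_graphMap (e := e) hg.continuous
  -- the components of the field
  set X : Fin N → RN N → ℝ := fun i z => a z * (z i - x₀ i)
  have hcoord : ∀ i : Fin N, ContDiff ℝ 1 fun z : RN N => z i - x₀ i := fun i => by fun_prop
  have hX : ∀ i, ContDiff ℝ 1 (X i) := fun i => ha.mul (hcoord i)
  have hXs : ∀ i, tsupport (X i) ⊆ Metric.ball x r := fun i =>
    (tsupport_mul_subset_left).trans hsupp
  have hXc : ∀ i, HasCompactSupport (X i) := fun i =>
    hasCompactSupport_of_tsupport_subset_ball (hXs i)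
  have hdX : ∀ i z, fderiv ℝ (X i) z (EuclideanSpace.single i 1) =
      a z + fderiv ℝ a z (EuclideanSpace.single i 1) * (z i - x₀ i) := by
    intro i z
    have h1 := (ha.differentiable one_ne_zero z).hasFDerivAt
    have h2 : HasFDerivAt (fun z : RN N => z i - x₀ i) (EuclideanSpace.proj i : RN N →L[ℝ] ℝ) z :=
      (EuclideanSpace.proj i : RN N →L[ℝ] ℝ).hasFDerivAt.sub_const (x₀ i)
    have h3 : HasFDerivAt (X i) _ z := h1.mul h2
    rw [h3.fderiv]
    simp [mul_comm]
  have hsum : ∀ w : RN N, ∑ i, w i • EuclideanSpace.single i (1 : ℝ) = w := by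
    intro w
    have := (EuclideanSpace.basisFun (Fin N) ℝ).sum_repr w
    simpa using this
  have hdiv : ∀ z, N * a z + fderiv ℝ a z (z - x₀) =
      ∑ i, fderiv ℝ (X i) z (EuclideanSpace.single i 1) := by
    intro z
    simp only [hdX, Finset.sum_add_distrib, Finset.sum_const, Finset.card_univ, Fintype.card_fin,
      nsmul_eq_mul]
    conv_lhs => rw [← hsum (z - x₀), map_sum]
    simp [mul_comm]
  have hintX : ∀ i, Integrable fun z => fderiv ℝ (X i) z (EuclideanSpace.single i 1) := fun i =>
    (((hX i).continuous_fderiv one_ne_zero).clm_apply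
      continuous_const).integrable_of_hasCompactSupport
        (((hXc i).fderiv ℝ).mono fun y hy h0 => hy (by simp [h0]))
  have hflux : ∫ z in Ω, (N * a z + fderiv ℝ a z (z - x₀)) =
      ∫ y, (fderiv ℝ g y ((ℝ ∙ e)ᗮ.orthogonalProjectionOnto (graphMap e g y - x₀)) -
        inner ℝ e (graphMap e g y - x₀)) * a (graphMap e g y) := by
    simp only [hdiv]
    rw [integral_finsetSum _ fun i _ => (hintX i).restrict]
    simp only [h.setIntegral_fderiv hΩ (hX _) (hXs _)]
    rw [← integral_finsetSum]
    · congr 1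
      ext y
      conv_rhs => rw [← hsum (graphMap e g y - x₀)]
      simp only [map_sum, map_smul, inner_sum, inner_smul_right, ← Finset.sum_sub_distrib,
        Finset.sum_mul, X, smul_eq_mul]
      refine Finset.sum_congr rfl fun i _ => ?_
      simp only [PiLp.sub_apply]
      ring
    · intro i _
      refine Continuous.integrable_of_hasCompactSupport ?_
        (((hXc i).comp_isClosedEmbedding hemb).mono fun y hy h0 => hy ?_)
      · have := (hX i).continuous.comp hemb.continuous
        exact ((hDg.clm_apply continuous_const).sub continuous_const).mul this
      · have h0' : X i (graphMap e g y) = 0 := h0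
        exact mul_eq_zero_of_right _ h0'
  have hacΓ : HasCompactSupport fun y => a (graphMap e g y) := hac.comp_isClosedEmbedding hemb
  have hΓ := hemb.continuous
  have haΓ : Continuous fun y => a (graphMap e g y) := ha.continuous.comp hΓ
  have hcontw : Continuous fun y => √(1 + ‖fderiv ℝ g y‖ ^ 2) :=
    (continuous_const.add (hDg.norm.pow 2)).sqrt
  have hGint : Integrable fun y =>
      √(1 + ‖fderiv ℝ g y‖ ^ 2) * (a (graphMap e g y) * ‖graphMap e g y - x₀‖) := by
    refine Continuous.integrable_of_hasCompactSupport ?_ (hacΓ.mono fun y hy h0 => hy ?_)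
    · exact hcontw.mul (haΓ.mul (hΓ.sub continuous_const).norm)
    · simp [h0]
  have hFint : Integrable fun y =>
      (fderiv ℝ g y ((ℝ ∙ e)ᗮ.orthogonalProjectionOnto (graphMap e g y - x₀)) -
        inner ℝ e (graphMap e g y - x₀)) * a (graphMap e g y) := by
    refine Continuous.integrable_of_hasCompactSupport ?_ (hacΓ.mono fun y hy h0 => hy ?_)
    · refine ((hDg.clm_apply ?_).sub ?_).mul haΓ <;> fun_prop
    · simp [h0]
  -- Cauchy-Schwarz for the normal `(∇g, -1)`
  have hCS : ∀ (l : (ℝ ∙ e)ᗮ →L[ℝ] ℝ) (w : RN N),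
      l ((ℝ ∙ e)ᗮ.orthogonalProjectionOnto w) - inner ℝ e w ≤ √(1 + ‖l‖ ^ 2) * ‖w‖ := by
    intro l w
    set p := (ℝ ∙ e)ᗮ.orthogonalProjectionOnto w
    have h1 : |l p| ≤ ‖l‖ * ‖p‖ := l.le_opNorm p
    have h2 : ‖w‖ ^ 2 = ‖p‖ ^ 2 + (inner ℝ e w : ℝ) ^ 2 := by
      rw [← norm_add_smul_sq h.norm_eq, coe_orthogonalProjectionOnto h.norm_eq, sub_add_cancel]
    rw [← Real.sqrt_sq (norm_nonneg w), ← Real.sqrt_mul (by positivity)]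
    refine Real.le_sqrt_of_sq_le ?_
    rw [h2]
    have h3 := le_abs_self (l p)
    have h4 := neg_abs_le (inner ℝ e w : ℝ)
    have h5 : (l p - inner ℝ e w) ^ 2 ≤ (‖l‖ * ‖p‖ + |(inner ℝ e w : ℝ)|) ^ 2 := by
      refine sq_le_sq' ?_ ?_
      · have h6 := neg_abs_le (l p)
        have h7 := le_abs_self (inner ℝ e w : ℝ)
        linarith
      · linarith
    have h6 := sq_abs (inner ℝ e w : ℝ)
    nlinarith [sq_nonneg (‖l‖ * |(inner ℝ e w : ℝ)| - ‖p‖)]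
  rw [hflux]
  calc _ ≤ ENNReal.ofReal (∫ y, √(1 + ‖fderiv ℝ g y‖ ^ 2) *
        (a (graphMap e g y) * ‖graphMap e g y - x₀‖)) := by
        refine ENNReal.ofReal_le_ofReal (integral_mono hFint hGint fun y => ?_)
        have := mul_le_mul_of_nonneg_right (hCS (fderiv ℝ g y) (graphMap e g y - x₀))
          (hnn (graphMap e g y))
        dsimp only
        linarith
    _ = ∫⁻ y, ENNReal.ofReal √(1 + ‖fderiv ℝ g y‖ ^ 2) *
        ENNReal.ofReal (a (graphMap e g y) * ‖graphMap e g y - x₀‖) := by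
        rw [ofReal_integral_eq_lintegral_ofReal hGint (ae_of_all _ fun y =>
          mul_nonneg (Real.sqrt_nonneg _) (mul_nonneg (hnn _) (norm_nonneg _)))]
        simp only [ENNReal.ofReal_mul (Real.sqrt_nonneg _)]
    _ ≤ _ := h.lintegral_graphMap_le hΩ (f := fun z => ENNReal.ofReal (a z * ‖z - x₀‖))
        (ha.continuous.mul (by fun_prop)).measurable.ennreal_ofReal fun z hz => by
          rw [image_eq_zero_of_notMem_tsupport fun hmem => hz (hsupp hmem), zero_mul,
            ENNReal.ofReal_zero]

end IsGraphChart

/-- A finite smooth partition of unity on `Ω̄`, each member of which is supported well inside a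
graph chart. -/
lemma IsBoundedSmoothDomain.exists_partition {N : ℕ} (hN : 1 ≤ N) {Ω : Set (RN N)}
    (hΩ : IsBoundedSmoothDomain Ω) :
    ∃ (t : Finset (RN N)) (r : RN N → ℝ) (e : RN N → RN N) (γ : RN N → RN N → ℝ)
      (ψ : RN N → RN N → ℝ), (∀ i ∈ t, IsGraphChart Ω i (r i) (e i) (γ i)) ∧
      (∀ i, ContDiff ℝ ∞ (ψ i)) ∧ (∀ i z, 0 ≤ ψ i z) ∧
      (∀ i ∈ t, tsupport (ψ i) ⊆ Metric.ball i (r i / 2)) ∧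
      ∀ z ∈ closure Ω, ∑ i ∈ t, ψ i z = 1 := by
  have h : ∀ x : RN N, ∃ r e γ, x ∈ closure Ω → IsGraphChart Ω x r e γ := by
    intro x
    by_cases hx : x ∈ closure Ω
    · obtain ⟨r, e, γ, h⟩ := hΩ.exists_isGraphChart hN hx
      exact ⟨r, e, γ, fun _ => h⟩
    · exact ⟨0, 0, 0, fun h => absurd h hx⟩
  choose r e γ h using h
  have hcomp : IsCompact (closure Ω) := hΩ.isBounded.isCompact_closure
  obtain ⟨t, htΩ, ht⟩ := hcomp.elim_nhds_subcover (fun x => Metric.ball x (r x / 2))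
    fun x hx => Metric.ball_mem_nhds x (half_pos (h x hx).r_pos)
  obtain ⟨f, hf⟩ := SmoothPartitionOfUnity.exists_isSubordinate (modelWithCornersSelf ℝ (RN N))
    (isClosed_closure (s := Ω)) (fun i : t => Metric.ball (i : RN N) (r i / 2))
    (fun i => Metric.isOpen_ball) (by
      intro x hx
      obtain ⟨i, hi, hxi⟩ := mem_iUnion₂.1 (ht hx)
      exact mem_iUnion.2 ⟨⟨i, hi⟩, hxi⟩)
  classical
  refine ⟨t, r, e, γ, fun i => if hi : i ∈ t then f ⟨i, hi⟩ else 0,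
    fun i hi => h i (htΩ i hi), fun i => ?_, fun i z => ?_, fun i hi => ?_, fun z hz => ?_⟩
  · by_cases hi : i ∈ t
    · simp only [hi, dite_true]
      exact (f ⟨i, hi⟩).contMDiff.contDiff
    · simp only [hi, dite_false]
      exact contDiff_const
  · by_cases hi : i ∈ t
    · simp only [hi, dite_true]
      exact f.nonneg _ _
    · simp [hi]
  · simp only [hi, dite_true]
    exact hf ⟨i, hi⟩
  · have h1 := f.sum_eq_one hz
    rw [finsum_eq_sum_of_fintype] at h1
    rw [← h1, ← Finset.sum_coe_sort t]
    refine Finset.sum_congr rfl fun i _ => ?_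
    simp

namespace IsBoundedSmoothDomain

variable {N : ℕ} {Ω : Set (RN N)}

lemma integrableOn_of_continuous (hΩ : IsBoundedSmoothDomain Ω) {F : Type*}
    [NormedAddCommGroup F] {f : RN N → F} (hf : Continuous f) : IntegrableOn f Ω :=
  (hf.continuousOn.integrableOn_compact hΩ.isBounded.isCompact_closure).mono_set subset_closure

/-- The trace inequality for functions that are `C^1` up to the boundary. -/
lemma exists_trace_inequality (hN : 1 ≤ N) (hΩ : IsBoundedSmoothDomain Ω) :
    ∃ C : NNReal, ∀ φ : RN N → ℝ, ContDiff ℝ 1 φ →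
      ∫⁻ z, ENNReal.ofReal (φ z ^ 2) ∂(surfaceMeasure Ω) ≤
        C * ∫⁻ z in Ω, ENNReal.ofReal (φ z ^ 2 + ‖fderiv ℝ φ z‖ ^ 2) := by
  obtain ⟨t, r, e, γ, ψ, hchart, hψ, hψ0, hψs, hψ1⟩ := hΩ.exists_partition hN
  have hψ' : ∀ i, ContDiff ℝ 1 (ψ i) := fun i => (hψ i).of_le (by exact_mod_cast le_top)
  have hloc : ∀ i : RN N, ∃ C : NNReal, i ∈ t → ∀ φ : RN N → ℝ, ContDiff ℝ 1 φ →
      ∫⁻ z, ENNReal.ofReal (ψ i z * φ z ^ 2) ∂(surfaceMeasure Ω) ≤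
        C * ∫⁻ z in Ω, ENNReal.ofReal (φ z ^ 2 + ‖fderiv ℝ φ z‖ ^ 2) := by
    intro i
    by_cases hi : i ∈ t
    swap
    · exact ⟨0, fun h => absurd h hi⟩
    have hsub : tsupport (ψ i) ⊆ Metric.ball i (r i) := (hψs i hi).trans
      (Metric.ball_subset_ball (half_le_self (hchart i hi).r_pos.le))
    have hcs := hasCompactSupport_of_tsupport_subset_ball hsub
    obtain ⟨M₀, hM₀⟩ := hcs.exists_bound_of_continuous (hψ' i).continuous
    obtain ⟨M₁, hM₁⟩ := (hcs.fderiv ℝ).exists_bound_of_continuous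
      ((hψ' i).continuous_fderiv one_ne_zero)
    obtain ⟨C, hC⟩ := (hchart i hi).exists_lintegral_le_fderiv hΩ.isOpen
    have hM₀0 : 0 ≤ M₀ := (norm_nonneg _).trans (hM₀ 0)
    have hM₁0 : 0 ≤ M₁ := (norm_nonneg _).trans (hM₁ 0)
    refine ⟨C * (M₀ + M₁).toNNReal, fun _ φ hφ => ?_⟩
    refine (hC (fun z => ψ i z * φ z ^ 2) ((hψ' i).mul (hφ.pow 2))
      (tsupport_mul_subset_left.trans hsub)
      fun z => mul_nonneg (hψ0 i z) (sq_nonneg _)).trans ?_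
    rw [ENNReal.coe_mul, mul_assoc]
    refine mul_le_mul_right ?_ _
    rw [← integral_neg]
    refine (Real.ofReal_le_enorm _).trans ((enorm_integral_le_lintegral_enorm _).trans ?_)
    rw [← lintegral_const_mul' _ _ ENNReal.coe_ne_top]
    refine lintegral_mono fun z => ?_
    have h1 := ((hψ' i).differentiable one_ne_zero z).hasFDerivAt
    have h2 := (hφ.differentiable one_ne_zero z).hasFDerivAt
    have h3 : HasFDerivAt (fun z => ψ i z * φ z ^ 2) _ z := h1.mul (h2.pow 2)
    rw [h3.fderiv, enorm_neg, Real.enorm_eq_ofReal_abs,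
      show (((M₀ + M₁).toNNReal : NNReal) : ℝ≥0∞) = ENNReal.ofReal (M₀ + M₁) from rfl,
      ← ENNReal.ofReal_mul (by positivity)]
    refine ENNReal.ofReal_le_ofReal ?_
    have hψz : |ψ i z| ≤ M₀ := hM₀ z
    have hde : |fderiv ℝ (ψ i) z (e i)| ≤ M₁ := by
      have := (fderiv ℝ (ψ i) z).le_opNorm (e i)
      rw [(hchart i hi).norm_eq, mul_one] at this
      exact this.trans (hM₁ z)
    have hdφ : |fderiv ℝ φ z (e i)| ≤ ‖fderiv ℝ φ z‖ := by
      have := (fderiv ℝ φ z).le_opNorm (e i)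
      rwa [(hchart i hi).norm_eq, mul_one] at this
    simp only [add_apply, smul_apply, smul_eq_mul,
      nsmul_eq_mul, Nat.cast_ofNat, Nat.add_one_sub_one, pow_one]
    set p := fderiv ℝ φ z (e i)
    set q := fderiv ℝ (ψ i) z (e i)
    set D := ‖fderiv ℝ φ z‖
    calc |ψ i z * (2 * φ z * p) + φ z ^ 2 * q|
        ≤ |ψ i z * (2 * φ z * p)| + |φ z ^ 2 * q| := abs_add_le _ _
      _ = |ψ i z| * (2 * |φ z| * |p|) + φ z ^ 2 * |q| := by
          simp [abs_mul]
      _ ≤ M₀ * (2 * |φ z| * D) + φ z ^ 2 * M₁ := by gcongr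
      _ ≤ (M₀ + M₁) * (φ z ^ 2 + D ^ 2) := by
          have h4 : 2 * |φ z| * D ≤ φ z ^ 2 + D ^ 2 := by
            have := sq_nonneg (|φ z| - D)
            have h5 := sq_abs (φ z)
            nlinarith
          have h5 := mul_le_mul_of_nonneg_left h4 hM₀0
          have h6 := mul_nonneg hM₁0 (sq_nonneg D)
          linarith
  choose C hC using hloc
  refine ⟨∑ i ∈ t, C i, fun φ hφ => ?_⟩
  calc ∫⁻ z, ENNReal.ofReal (φ z ^ 2) ∂(surfaceMeasure Ω)
      = ∫⁻ z, ∑ i ∈ t, ENNReal.ofReal (ψ i z * φ z ^ 2) ∂(surfaceMeasure Ω) := by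
        refine setLIntegral_congr_fun isClosed_frontier.measurableSet fun z hz => ?_
        rw [← ENNReal.ofReal_sum_of_nonneg fun i _ => mul_nonneg (hψ0 i z) (sq_nonneg _),
          ← Finset.sum_mul, hψ1 z (frontier_subset_closure hz), one_mul]
    _ = ∑ i ∈ t, ∫⁻ z, ENNReal.ofReal (ψ i z * φ z ^ 2) ∂(surfaceMeasure Ω) :=
        lintegral_finsetSum _ fun i _ =>
          ((hψ' i).continuous.mul (hφ.continuous.pow 2)).measurable.ennreal_ofReal
    _ ≤ ∑ i ∈ t, C i * ∫⁻ z in Ω, ENNReal.ofReal (φ z ^ 2 + ‖fderiv ℝ φ z‖ ^ 2) :=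
        Finset.sum_le_sum fun i hi => hC i hi φ hφ
    _ = _ := by rw [← Finset.sum_mul, ENNReal.ofNNReal_finsetSum]

lemma lintegral_trace_lt_top (hN : 1 ≤ N) (hΩ : IsBoundedSmoothDomain Ω) {φ : RN N → ℝ}
    (hφ : ContDiff ℝ 1 φ) :
    ∫⁻ z, ENNReal.ofReal (φ z ^ 2) ∂(surfaceMeasure Ω) < ⊤ := by
  obtain ⟨C, hC⟩ := hΩ.exists_trace_inequality hN
  refine (hC φ hφ).trans_lt (ENNReal.mul_lt_top ENNReal.coe_lt_top ?_)
  have hint : IntegrableOn (fun z => φ z ^ 2 + ‖fderiv ℝ φ z‖ ^ 2) Ω :=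
    hΩ.integrableOn_of_continuous
      ((hφ.continuous.pow 2).add ((hφ.continuous_fderiv one_ne_zero).norm.pow 2))
  exact hint.lintegral_lt_top

lemma diam_pos (hN : 1 ≤ N) (hΩ : IsBoundedSmoothDomain Ω) : 0 < Metric.diam Ω := by
  have : Nontrivial (RN N) := by
    have : Nonempty (Fin N) := ⟨⟨0, hN⟩⟩
    infer_instance
  obtain ⟨x, hx⟩ := hΩ.isConnected.nonempty
  have hnt : Ω.Nontrivial := by
    rw [← Set.not_subsingleton_iff]
    intro hs
    have hsing := hs.eq_singleton_of_mem hx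
    exact not_isOpen_singleton x (hsing ▸ hΩ.isOpen)
  obtain ⟨y, hy, hne⟩ := hnt.exists_ne x
  exact (dist_pos.2 hne).trans_le (Metric.dist_le_diam_of_mem hΩ.isBounded hy hx)

/-- The divergence theorem for the field `φ^2 (z - x₀)`, whose outward flux through the boundary is
at most `diam Ω · ∫_∂Ω φ^2`. -/
lemma integral_div_le (hN : 1 ≤ N) (hΩ : IsBoundedSmoothDomain Ω) {φ : RN N → ℝ}
    (hφ : ContDiff ℝ 1 φ) {x₀ : RN N} (hx₀ : x₀ ∈ Ω) :
    ∫ z in Ω, (N * φ z ^ 2 + 2 * φ z * fderiv ℝ φ z (z - x₀)) ≤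
      Metric.diam Ω * ∫ z, φ z ^ 2 ∂(surfaceMeasure Ω) := by
  obtain ⟨t, r, e, γ, ψ, hchart, hψ, hψ0, hψs, hψ1⟩ := hΩ.exists_partition hN
  have hψ' : ∀ i, ContDiff ℝ 1 (ψ i) := fun i => (hψ i).of_le (by exact_mod_cast le_top)
  set a : RN N → RN N → ℝ := fun i z => ψ i z * φ z ^ 2
  have ha : ∀ i, ContDiff ℝ 1 (a i) := fun i => (hψ' i).mul (hφ.pow 2)
  have hsum : ∀ z ∈ Ω, N * φ z ^ 2 + 2 * φ z * fderiv ℝ φ z (z - x₀) =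
      ∑ i ∈ t, (N * a i z + fderiv ℝ (a i) z (z - x₀)) := by
    intro z hz
    have h1 : ∀ w ∈ Ω, ∑ i ∈ t, a i w = φ w ^ 2 := fun w hw => by
      rw [← Finset.sum_mul, hψ1 w (subset_closure hw), one_mul]
    have h2 : HasFDerivAt (fun w => ∑ i ∈ t, a i w) (∑ i ∈ t, fderiv ℝ (a i) z) z :=
      HasFDerivAt.fun_sum fun i _ => ((ha i).differentiable one_ne_zero z).hasFDerivAt
    have h3 := (hφ.differentiable one_ne_zero z).hasFDerivAt.pow 2
    have h4 : (fun w => ∑ i ∈ t, a i w) =ᶠ[𝓝 z] φ ^ 2 := by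
      filter_upwards [hΩ.isOpen.mem_nhds hz] with w hw using h1 w hw
    have h5 := h4.hasFDerivAt_iff.1 h2 |>.unique h3
    rw [Finset.sum_add_distrib, ← Finset.mul_sum, h1 z hz]
    have h6 := congrArg (fun l => l (z - x₀)) h5
    simp only [sum_apply] at h6
    rw [h6]
    simp
  have hint : ∀ i, IntegrableOn (fun z => N * a i z + fderiv ℝ (a i) z (z - x₀)) Ω := fun i =>
    hΩ.integrableOn_of_continuous ((continuous_const.mul (ha i).continuous).add
      (((ha i).continuous_fderiv one_ne_zero).clm_apply (by fun_prop)))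
  have hfin := hΩ.lintegral_trace_lt_top hN hφ
  have hBint : Integrable (fun z => φ z ^ 2) (surfaceMeasure Ω) := by
    refine ⟨(hφ.continuous.pow 2).aestronglyMeasurable, ?_⟩
    rw [hasFiniteIntegral_iff_ofReal (ae_of_all _ fun z => sq_nonneg _)]
    exact hfin
  have hkey : ENNReal.ofReal (∫ z in Ω, (N * φ z ^ 2 + 2 * φ z * fderiv ℝ φ z (z - x₀))) ≤
      ENNReal.ofReal (Metric.diam Ω * ∫ z, φ z ^ 2 ∂(surfaceMeasure Ω)) := by
    rw [setIntegral_congr_fun hΩ.isOpen.measurableSet hsum,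
      integral_finsetSum _ fun i _ => hint i]
    calc ENNReal.ofReal (∑ i ∈ t, ∫ z in Ω, (N * a i z + fderiv ℝ (a i) z (z - x₀)))
        ≤ ∑ i ∈ t, ENNReal.ofReal (∫ z in Ω, (N * a i z + fderiv ℝ (a i) z (z - x₀))) :=
          Finset.le_sum_of_subadditive _ ENNReal.ofReal_zero.le (fun _ _ => ENNReal.ofReal_add_le) _ _
      _ ≤ ∑ i ∈ t, ∫⁻ z, ENNReal.ofReal (a i z * ‖z - x₀‖) ∂(surfaceMeasure Ω) :=
          Finset.sum_le_sum fun i hi => (hchart i hi).ofReal_integral_div_le hΩ.isOpen (ha i)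
            (tsupport_mul_subset_left.trans ((hψs i hi).trans
              (Metric.ball_subset_ball (half_le_self (hchart i hi).r_pos.le))))
            (fun z => mul_nonneg (hψ0 i z) (sq_nonneg _)) x₀
      _ = ∫⁻ z, ∑ i ∈ t, ENNReal.ofReal (a i z * ‖z - x₀‖) ∂(surfaceMeasure Ω) :=
          (lintegral_finsetSum _ fun i _ =>
            ((ha i).continuous.mul (by fun_prop)).measurable.ennreal_ofReal).symm
      _ ≤ ∫⁻ z, ENNReal.ofReal (Metric.diam Ω * φ z ^ 2) ∂(surfaceMeasure Ω) := by
          refine setLIntegral_mono' isClosed_frontier.measurableSet fun z hz => ?_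
          have hzc := frontier_subset_closure hz
          rw [← ENNReal.ofReal_sum_of_nonneg fun i _ =>
            mul_nonneg (mul_nonneg (hψ0 i z) (sq_nonneg _)) (norm_nonneg _)]
          refine ENNReal.ofReal_le_ofReal ?_
          rw [← Finset.sum_mul, ← Finset.sum_mul, hψ1 z hzc, one_mul, mul_comm]
          refine mul_le_mul_of_nonneg_right ?_ (sq_nonneg _)
          rw [← dist_eq_norm, ← Metric.diam_closure]
          exact Metric.dist_le_diam_of_mem hΩ.isBounded.closure hzc (subset_closure hx₀)
      _ = _ := by
          rw [← integral_const_mul, ofReal_integral_eq_lintegral_ofReal (hBint.const_mul _)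
            (ae_of_all _ fun z => mul_nonneg Metric.diam_nonneg (sq_nonneg _))]
  exact (ENNReal.ofReal_le_ofReal_iff (mul_nonneg Metric.diam_nonneg
    (integral_nonneg fun z => sq_nonneg _))).1 hkey

/-- The Poincaré-type inequality for functions that are `C^1` up to the boundary. -/
lemma poincare_of_contDiff (hN : 1 ≤ N) (hΩ : IsBoundedSmoothDomain Ω) {φ : RN N → ℝ}
    (hφ : ContDiff ℝ 1 φ) {δ : ℝ} (hδ : 0 < δ) :
    δ * (N / Metric.diam Ω - δ) * ∫ z in Ω, φ z ^ 2 ≤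
      (∫ z in Ω, ‖fderiv ℝ φ z‖ ^ 2) + δ * ∫ z, φ z ^ 2 ∂(surfaceMeasure Ω) := by
  have hd := hΩ.diam_pos hN
  obtain ⟨x₀, hx₀⟩ := hΩ.isConnected.nonempty
  have hflux := hΩ.integral_div_le hN hφ hx₀
  set d := Metric.diam Ω
  have hDφ := hφ.continuous_fderiv one_ne_zero
  have hφint : IntegrableOn (fun z => φ z ^ 2) Ω :=
    hΩ.integrableOn_of_continuous (hφ.continuous.pow 2)
  have hDint : IntegrableOn (fun z => ‖fderiv ℝ φ z‖ ^ 2) Ω :=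
    hΩ.integrableOn_of_continuous (hDφ.norm.pow 2)
  have hle : (N - d * δ) * (∫ z in Ω, φ z ^ 2) - d / δ * ∫ z in Ω, ‖fderiv ℝ φ z‖ ^ 2 ≤
      ∫ z in Ω, (N * φ z ^ 2 + 2 * φ z * fderiv ℝ φ z (z - x₀)) := by
    rw [← integral_const_mul, ← integral_const_mul,
      ← integral_sub (hφint.const_mul _) (hDint.const_mul _)]
    refine setIntegral_mono_on ((hφint.const_mul _).sub (hDint.const_mul _)) ?_
      hΩ.isOpen.measurableSet fun z hz => ?_
    · exact hΩ.integrableOn_of_continuous ((continuous_const.mul (hφ.continuous.pow 2)).add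
        ((continuous_const.mul hφ.continuous).mul (hDφ.clm_apply (by fun_prop))))
    · have h1 : |fderiv ℝ φ z (z - x₀)| ≤ ‖fderiv ℝ φ z‖ * d := by
        refine ((fderiv ℝ φ z).le_opNorm _).trans (mul_le_mul_of_nonneg_left ?_ (norm_nonneg _))
        rw [← dist_eq_norm]
        exact Metric.dist_le_diam_of_mem hΩ.isBounded hz hx₀
      set D := ‖fderiv ℝ φ z‖
      have h2 : |φ z * fderiv ℝ φ z (z - x₀)| ≤ |φ z| * (D * d) := by
        rw [abs_mul]
        exact mul_le_mul_of_nonneg_left h1 (abs_nonneg _)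
      have h3 := (abs_le.1 h2).1
      -- Young's inequality with weight `δ`
      have h4 : 2 * (|φ z| * D) ≤ δ * φ z ^ 2 + D ^ 2 / δ := by
        have h5 : δ * φ z ^ 2 + D ^ 2 / δ - 2 * (|φ z| * D) = (δ * |φ z| - D) ^ 2 / δ := by
          rw [← sq_abs (φ z)]
          field_simp
          ring
        have h6 : 0 ≤ (δ * |φ z| - D) ^ 2 / δ := by positivity
        linarith
      have h5 := mul_le_mul_of_nonneg_left h4 hd.le
      have h6 : d / δ * D ^ 2 = d * (D ^ 2 / δ) := by ring
      rw [h6]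
      linarith
  have h1 := hle.trans hflux
  have h2 := mul_le_mul_of_nonneg_left h1 (div_pos hδ hd).le
  have h3 : δ / d * ((N - d * δ) * (∫ z in Ω, φ z ^ 2) - d / δ * ∫ z in Ω, ‖fderiv ℝ φ z‖ ^ 2) =
      δ * (N / d - δ) * (∫ z in Ω, φ z ^ 2) - ∫ z in Ω, ‖fderiv ℝ φ z‖ ^ 2 := by
    field_simp
  have h4 : δ / d * (d * ∫ z, φ z ^ 2 ∂(surfaceMeasure Ω)) =
      δ * ∫ z, φ z ^ 2 ∂(surfaceMeasure Ω) := by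
    field_simp
  rw [h3, h4] at h2
  linarith

end IsBoundedSmoothDomain

/-! ### Mollification in `L^2` -/

lemma eLpNorm_two_sq {X F : Type*} [MeasurableSpace X] [NormedAddCommGroup F] (μ : Measure X)
    (f : X → F) : eLpNorm f 2 μ ^ 2 = ∫⁻ x, ‖f x‖ₑ ^ 2 ∂μ := by
  have := eLpNorm_nnreal_pow_eq_lintegral (f := f) (μ := μ) (p := 2) two_ne_zero
  simpa using this

section Mollification

open scoped Convolution

variable {E F : Type*} [NormedAddCommGroup E] [InnerProductSpace ℝ E] [FiniteDimensional ℝ E]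
  [MeasurableSpace E] [BorelSpace E] [NormedAddCommGroup F]

/-- Translations are continuous in `L^2`. -/
lemma tendsto_eLpNorm_translate_sub {f : E → F} (hf : MemLp f 2 (volume : Measure E)) :
    Tendsto (fun z => eLpNorm (fun x => f (x - z) - f x) 2 (volume : Measure E)) (𝓝 0) (𝓝 0) := by
  have : Fact ((1 : ℝ≥0∞) ≤ 2) := ⟨one_le_two⟩
  set g : E → C(E, E) := fun z => ⟨fun x => x - z, by fun_prop⟩
  have hg : Continuous g :=
    (ContinuousMap.curry ⟨fun p : E × E => p.2 - p.1, by fun_prop⟩).continuous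
  have hgm : ∀ z, MeasurePreserving (g z) (volume : Measure E) volume := fun z =>
    measurePreserving_sub_right volume z
  have hcont : Continuous fun z => Lp.compMeasurePreserving (g z) (hgm z) (hf.toLp f) :=
    continuous_const.compMeasurePreservingLp hg hgm (by simp)
  have h0 : Lp.compMeasurePreserving (g 0) (hgm 0) (hf.toLp f) = hf.toLp f := by
    rw [Lp.toLp_compMeasurePreserving]
    congr 1
    ext x
    simp [g]
  have hlim := (hcont.edist continuous_const).tendsto (0 : E) (f := fun z =>
    edist (Lp.compMeasurePreserving (g z) (hgm z) (hf.toLp f)) (hf.toLp f))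
  rw [h0, edist_self] at hlim
  refine hlim.congr fun z => ?_
  rw [Lp.toLp_compMeasurePreserving, Lp.edist_toLp_toLp]
  rfl

variable [NormedSpace ℝ F]

/-- Convolution with a probability density `K` supported in the ball of radius `R` moves `f` in
`L^2` by at most as much as a translation by a vector shorter than `R` does. -/
lemma eLpNorm_convolution_sub_le {K : E → ℝ} (hKc : Continuous K) (hKs : HasCompactSupport K)
    (hK0 : ∀ z, 0 ≤ K z) (hK1 : ∫ z, K z = 1) {R : ℝ} (hKR : ∀ z, K z ≠ 0 → ‖z‖ < R)
    [CompleteSpace F] {f : E → F} (hf : MemLp f 2 (volume : Measure E)) {ε : ℝ≥0∞}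
    (hε : ∀ z : E, ‖z‖ < R → eLpNorm (fun x => f (x - z) - f x) 2 (volume : Measure E) ≤ ε) :
    eLpNorm (fun x => (K ⋆[ContinuousLinearMap.lsmul ℝ ℝ, volume] f) x - f x) 2
      (volume : Measure E) ≤ ε := by
  have hK1' : ∫⁻ z, ‖K z‖ₑ = 1 := by
    have hKi : Integrable K := hKc.integrable_of_hasCompactSupport hKs
    have h := ofReal_integral_eq_lintegral_ofReal hKi
      (ae_of_all _ hK0)
    rw [hK1, ENNReal.ofReal_one] at h
    rw [h]
    exact lintegral_congr fun z => Real.enorm_of_nonneg (hK0 z)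
  have hfm := hf.aestronglyMeasurable
  have hsub : AEStronglyMeasurable (fun p : E × E => f (p.1 - p.2) - f p.1)
      ((volume : Measure E).prod volume) :=
    (hfm.comp_quasiMeasurePreserving (quasiMeasurePreserving_sub volume volume)).sub
      hfm.comp_fst
  have hloc : LocallyIntegrable f := hf.locallyIntegrable one_le_two
  have hpt : ∀ x, ‖(K ⋆[ContinuousLinearMap.lsmul ℝ ℝ, volume] f) x - f x‖ₑ ^ 2 ≤
      ∫⁻ z, ‖K z‖ₑ * ‖f (x - z) - f x‖ₑ ^ 2 := by
    intro x
    have hint : Integrable fun z => K z • f (x - z) :=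
      hKs.convolutionExists_left (ContinuousLinearMap.lsmul ℝ ℝ) hKc hloc x
    have hint' : Integrable fun z => K z • f x :=
      (hKc.integrable_of_hasCompactSupport hKs).smul_const (f x)
    have heq : (K ⋆[ContinuousLinearMap.lsmul ℝ ℝ, volume] f) x - f x =
        ∫ z, K z • (f (x - z) - f x) := by
      simp only [smul_sub]
      rw [convolution_lsmul, integral_sub hint hint', integral_smul_const, hK1, one_smul]
    have hm : AEMeasurable fun z => ‖f (x - z) - f x‖ₑ :=
      ((hfm.comp_quasiMeasurePreserving (quasiMeasurePreserving_sub_left volume x)).sub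
        aestronglyMeasurable_const).enorm
    have hKm : Measurable fun z => ‖K z‖ₑ := hKc.measurable.enorm
    -- Cauchy-Schwarz for the density `K`
    have hCS : ∫⁻ z, ‖K z‖ₑ * ‖f (x - z) - f x‖ₑ ≤
        (∫⁻ z, ‖K z‖ₑ * ‖f (x - z) - f x‖ₑ ^ 2) ^ (1 / 2 : ℝ) := by
      have h := ENNReal.lintegral_mul_le_Lp_mul_Lq (volume : Measure E)
        Real.HolderConjugate.two_two
        (f := fun z => ‖K z‖ₑ ^ (1 / 2 : ℝ)) (g := fun z => ‖K z‖ₑ ^ (1 / 2 : ℝ) *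
          ‖f (x - z) - f x‖ₑ) (hKm.pow_const _).aemeasurable
          ((hKm.pow_const _).aemeasurable.mul hm)
      have hhalf : ∀ z, ‖K z‖ₑ ^ (1 / 2 : ℝ) * ‖K z‖ₑ ^ (1 / 2 : ℝ) = ‖K z‖ₑ := fun z => by
        rw [← ENNReal.rpow_add_of_nonneg _ _ (by norm_num) (by norm_num)]
        norm_num
      have hsq : ∀ z, (‖K z‖ₑ ^ (1 / 2 : ℝ)) ^ (2 : ℝ) = ‖K z‖ₑ := fun z => by
        rw [← ENNReal.rpow_mul]
        norm_num
      simp only [Pi.mul_apply, ← mul_assoc, hhalf,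
        ENNReal.mul_rpow_of_nonneg _ _ (zero_le_two : (0 : ℝ) ≤ 2), hsq, hK1', ENNReal.one_rpow,
        one_mul, ENNReal.rpow_two] at h
      exact h
    rw [heq]
    calc ‖∫ z, K z • (f (x - z) - f x)‖ₑ ^ 2
        ≤ (∫⁻ z, ‖K z‖ₑ * ‖f (x - z) - f x‖ₑ) ^ 2 := by
          refine pow_le_pow_left' ((enorm_integral_le_lintegral_enorm _).trans (le_of_eq ?_)) 2
          exact lintegral_congr fun z => enorm_smul _ _
      _ ≤ ((∫⁻ z, ‖K z‖ₑ * ‖f (x - z) - f x‖ₑ ^ 2) ^ (1 / 2 : ℝ)) ^ 2 :=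
          pow_le_pow_left' hCS 2
      _ = _ := by
          rw [← ENNReal.rpow_two, ← ENNReal.rpow_mul]
          norm_num
  have hfinal : eLpNorm (fun x => (K ⋆[ContinuousLinearMap.lsmul ℝ ℝ, volume] f) x - f x) 2
      (volume : Measure E) ^ 2 ≤ ε ^ 2 := by
    rw [eLpNorm_two_sq]
    calc _ ≤ ∫⁻ x, ∫⁻ z, ‖K z‖ₑ * ‖f (x - z) - f x‖ₑ ^ 2 := lintegral_mono hpt
      _ = ∫⁻ z, ∫⁻ x, ‖K z‖ₑ * ‖f (x - z) - f x‖ₑ ^ 2 := by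
          refine lintegral_lintegral_swap ?_
          exact (hKc.measurable.enorm.comp measurable_snd).aemeasurable.mul (hsub.enorm.pow_const 2)
      _ ≤ ∫⁻ z, ‖K z‖ₑ * ε ^ 2 := by
          refine lintegral_mono fun z => ?_
          rw [lintegral_const_mul' _ _ enorm_ne_top, ← eLpNorm_two_sq]
          by_cases hz : K z = 0
          · simp [hz]
          · exact mul_le_mul_right (pow_le_pow_left' (hε z (hKR z hz)) 2) _
      _ = ε ^ 2 := by
          rw [lintegral_mul_const _ hKc.measurable.enorm, hK1', one_mul]
  exact (ENNReal.pow_le_pow_left_iff two_ne_zero).1 hfinal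

/-- Convolutions with probability densities whose supports shrink to the origin converge in
`L^2`. -/
lemma tendsto_eLpNorm_convolution_sub {K : ℕ → E → ℝ} (hKc : ∀ k, Continuous (K k))
    (hKs : ∀ k, HasCompactSupport (K k)) (hK0 : ∀ k z, 0 ≤ K k z) (hK1 : ∀ k, ∫ z, K k z = 1)
    {R : ℕ → ℝ} (hR : Tendsto R atTop (𝓝 0)) (hKR : ∀ k z, K k z ≠ 0 → ‖z‖ < R k)
    [CompleteSpace F] {f : E → F} (hf : MemLp f 2 (volume : Measure E)) :
    Tendsto (fun k => eLpNorm
      (fun x => (K k ⋆[ContinuousLinearMap.lsmul ℝ ℝ, volume] f) x - f x) 2 (volume : Measure E))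
      atTop (𝓝 0) := by
  rw [ENNReal.tendsto_nhds_zero]
  intro ε hε
  obtain ⟨r, hr, hball⟩ := Metric.eventually_nhds_iff.1
    (ENNReal.tendsto_nhds_zero.1 (tendsto_eLpNorm_translate_sub hf) ε hε)
  filter_upwards [hR.eventually (gt_mem_nhds hr)] with k hk
  refine eLpNorm_convolution_sub_le (hKc k) (hKs k) (hK0 k) (hK1 k) (hKR k) hf fun z hz => ?_
  exact hball (by rw [dist_zero_right]; exact hz.trans hk)

end Mollification

/-! ### Density of smooth functions in `H^1` -/

section Density

open scoped Convolution

variable {N : ℕ} {Ω : Set (RN N)}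

lemma gradient_apply_eq_fderiv (f : RN N → ℝ) (x : RN N) (i : Fin N) :
    gradient f x i = fderiv ℝ f x (EuclideanSpace.single i 1) := by
  rw [← InnerProductSpace.toDual_symm_apply, ← gradient, EuclideanSpace.inner_single_right]
  simp

lemma norm_gradient (f : RN N → ℝ) (x : RN N) : ‖gradient f x‖ = ‖fderiv ℝ f x‖ :=
  LinearIsometryEquiv.norm_map _ _

/-- If `v` has the weak gradient `H` as far as the test function `K (x - ·)` can see, then at `x`
the gradient of `K ⋆ v` is `K ⋆ H`. -/
lemma gradient_convolution {K : RN N → ℝ} (hK : ContDiff ℝ 1 K) (hKs : HasCompactSupport K)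
    {v : RN N → ℝ} {H : RN N → RN N} (hv : LocallyIntegrable v) (hH : LocallyIntegrable H)
    {x : RN N}
    (hweak : ∀ i, ∫ z, v z * fderiv ℝ (fun z => K (x - z)) z (EuclideanSpace.single i 1) =
      - ∫ z, H z i * K (x - z)) :
    gradient (K ⋆[ContinuousLinearMap.lsmul ℝ ℝ, volume] v) x =
      (K ⋆[ContinuousLinearMap.lsmul ℝ ℝ, volume] H) x := by
  ext i
  have h1 := hKs.hasFDerivAt_convolution_right (ContinuousLinearMap.lsmul ℝ ℝ).flip hv hK x
  rw [convolution_flip] at h1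
  rw [gradient_apply_eq_fderiv, h1.fderiv, convolution_precompR_apply _ hv (hKs.fderiv ℝ)
    (hK.continuous_fderiv one_ne_zero), convolution_def]
  have hd : ∀ z, fderiv ℝ (fun z => K (x - z)) z (EuclideanSpace.single i 1) =
      - fderiv ℝ K (x - z) (EuclideanSpace.single i 1) := by
    intro z
    have h2 := (hK.differentiable one_ne_zero (x - z)).hasFDerivAt.comp z
      ((hasFDerivAt_id z).const_sub x)
    have h3 : HasFDerivAt (fun z => K (x - z)) _ z := h2
    rw [h3.fderiv]
    simp
  have h4 := hweak i
  simp only [hd, mul_neg, integral_neg, neg_inj] at h4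
  have h5 : ∫ t, ((ContinuousLinearMap.lsmul ℝ ℝ).flip (v t))
      (fderiv ℝ K (x - t) (EuclideanSpace.single i 1)) =
        ∫ z, v z * fderiv ℝ K (x - z) (EuclideanSpace.single i 1) :=
    integral_congr_ae (ae_of_all _ fun t => by simp [mul_comm])
  rw [h5, h4, convolution_lsmul]
  have hint : Integrable fun t => K t • H (x - t) :=
    hKs.convolutionExists_left (ContinuousLinearMap.lsmul ℝ ℝ) hK.continuous hH x
  have h6 := (EuclideanSpace.proj i : RN N →L[ℝ] ℝ).integral_comp_comm hint
  have h7 : (EuclideanSpace.proj i : RN N →L[ℝ] ℝ) (∫ t, K t • H (x - t)) =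
      (∫ t, K t • H (x - t)) i := rfl
  rw [← h7, ← h6, ← integral_sub_left_eq_self _ volume x]
  exact integral_congr_ae (ae_of_all _ fun t => by simp [mul_comm])

/-- Moving up from a point of `Ω` by `(L + 1) ε` stays in `Ω`, even after a perturbation of size
`ε`, as long as it stays within the chart. -/
lemma IsGraphChart.exists_shift_mem {x₀ : RN N} {r : ℝ} {e : RN N} {γ : RN N → ℝ}
    (h : IsGraphChart Ω x₀ r e γ) :
    ∃ L : ℝ, 0 ≤ L ∧ ∀ ε : ℝ, 0 < ε → (L + 2) * ε ≤ r / 2 → ∀ x ∈ Ω,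
      ∀ w ∈ Metric.ball x₀ (r / 2), ‖w - (x + ((L + 1) * ε) • e)‖ ≤ ε → w ∈ Ω := by
  obtain ⟨L, hL⟩ := h.contDiff_one.contDiffOn.exists_lipschitzOnWith
    (s := Metric.closedBall 0 (‖x₀‖ + r)) one_ne_zero (convex_closedBall _ _)
    (isCompact_closedBall _ _)
  refine ⟨L, L.2, fun ε hε hεr x hx w hw hwx => ?_⟩
  have hL0 : (0 : ℝ) ≤ L := L.2
  have hdist : ‖w - x‖ ≤ (L + 2) * ε := by
    have h1 : w - x = (w - (x + ((L + 1) * ε) • e)) + ((L + 1) * ε) • e := by abel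
    rw [h1]
    refine (norm_add_le _ _).trans ?_
    rw [norm_smul, h.norm_eq, mul_one, Real.norm_of_nonneg (by positivity)]
    linarith
  have hwr : w ∈ Metric.ball x₀ r :=
    Metric.ball_subset_ball (half_le_self h.r_pos.le) hw
  have hxr : x ∈ Metric.ball x₀ r := by
    rw [Metric.mem_ball] at hw ⊢
    have h2 := dist_triangle x w x₀
    rw [dist_comm x w, dist_eq_norm w x] at h2
    linarith
  set P := (ℝ ∙ e)ᗮ.orthogonalProjectionOnto
  have hP : ∀ z ∈ Metric.ball x₀ r, P z ∈ Metric.closedBall 0 (‖x₀‖ + r) := by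
    intro z hz
    rw [mem_closedBall_zero_iff]
    rw [mem_ball_iff_norm] at hz
    have h1 : ‖P z‖ ≤ ‖z‖ := (ℝ ∙ e)ᗮ.norm_orthogonalProjectionOnto_apply_le z
    have h2 := norm_sub_norm_le z x₀
    linarith
  have hγ := hL.norm_sub_le (hP w hwr) (hP x hxr)
  set d := w - (x + ((L + 1) * ε) • e)
  have hwd : w = x + ((L + 1) * ε) • e + d := by simp [d]
  have hPe : P e = 0 := by
    ext1
    rw [coe_orthogonalProjectionOnto h.norm_eq, real_inner_self_eq_norm_sq, h.norm_eq]
    simp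
  have hPd : P w - P x = P d := by
    conv_lhs => rw [hwd]
    simp [hPe]
  have hPdn : ‖P d‖ ≤ ε := ((ℝ ∙ e)ᗮ.norm_orthogonalProjectionOnto_apply_le d).trans hwx
  have hinner : inner ℝ e x + (L + 1) * ε - ε ≤ inner ℝ e w := by
    have h1 : |inner ℝ e d| ≤ ε := by
      refine (abs_real_inner_le_norm _ _).trans ?_
      rwa [h.norm_eq, one_mul]
    have h2 := (abs_le.1 h1).1
    have h3 : inner ℝ e w = inner ℝ e x + (L + 1) * ε + inner ℝ e d := by
      conv_lhs => rw [hwd]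
      rw [inner_add_right, inner_add_right, inner_smul_right, real_inner_self_eq_norm_sq, h.norm_eq]
      ring
    linarith
  rw [h.mem_iff hwr, ← coe_orthogonalProjectionOnto h.norm_eq]
  have hx' := (h.mem_iff hxr).1 hx
  rw [← coe_orthogonalProjectionOnto h.norm_eq] at hx'
  rw [hPd, Real.norm_eq_abs] at hγ
  have h1 := (abs_le.1 hγ).2
  have h2 := mul_le_mul_of_nonneg_left hPdn hL0
  change γ (P w) < inner ℝ e w
  change γ (P x) < inner ℝ e x at hx'
  linarith

/-- The product rule for the weak gradient of a function in `H^1(Ω)`, localized by `ψ`: test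
functions need not vanish near `∂Ω` where `ψ` does. -/
lemma IsH1WithGradient.weak_gradient_mul (hΩ : IsBoundedSmoothDomain Ω) {u : RN N → ℝ}
    {G : RN N → RN N} (hu : IsH1WithGradient Ω u G) {ψ χ : RN N → ℝ} (hψ : ContDiff ℝ ∞ ψ)
    (hχ : ContDiff ℝ ∞ χ) (hψc : HasCompactSupport ψ) (h : tsupport ψ ∩ tsupport χ ⊆ Ω)
    (i : Fin N) :
    ∫ z in Ω, ψ z * u z * fderiv ℝ χ z (EuclideanSpace.single i 1) =
      - ∫ z in Ω, (ψ z • G z + u z • gradient ψ z) i * χ z := by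
  have hfin : IsFiniteMeasure (volumeOn Ω) :=
    isFiniteMeasure_restrict.2 hΩ.isBounded.measure_lt_top.ne
  have hψχc : HasCompactSupport fun z => ψ z * χ z := hψc.mul_right
  have hts : tsupport (fun z => ψ z * χ z) ⊆ Ω :=
    (subset_inter tsupport_mul_subset_left tsupport_mul_subset_right).trans h
  have hw := hu.weak_gradient _ (hψ.mul hχ) hψχc hts i
  have hψ1 : ContDiff ℝ 1 ψ := hψ.of_le (by exact_mod_cast le_top)
  have hχ1 : ContDiff ℝ 1 χ := hχ.of_le (by exact_mod_cast le_top)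
  have hd : ∀ z, fderiv ℝ (fun z => ψ z * χ z) z (EuclideanSpace.single i 1) =
      ψ z * fderiv ℝ χ z (EuclideanSpace.single i 1) +
        χ z * fderiv ℝ ψ z (EuclideanSpace.single i 1) := by
    intro z
    have h3 : HasFDerivAt (fun z => ψ z * χ z) _ z :=
      (hψ1.differentiable one_ne_zero z).hasFDerivAt.mul
        (hχ1.differentiable one_ne_zero z).hasFDerivAt
    rw [h3.fderiv]
    simp
  have hu1 : Integrable u (volumeOn Ω) := hu.memLp.integrable one_le_two
  have hG1 : Integrable (fun z => G z i) (volumeOn Ω) :=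
    (EuclideanSpace.proj i : RN N →L[ℝ] ℝ).integrable_comp
      (hu.memLp_gradient.integrable one_le_two)
  have hmul : ∀ {f c : RN N → ℝ}, Integrable f (volumeOn Ω) → Continuous c →
      HasCompactSupport c → Integrable (fun z => f z * c z) (volumeOn Ω) := by
    intro f c hf hc hcs
    obtain ⟨M, hM⟩ := hcs.exists_bound_of_continuous hc
    exact hf.mul_bdd hc.aestronglyMeasurable (ae_of_all _ hM)
  have hc1 : Continuous fun z => ψ z * fderiv ℝ χ z (EuclideanSpace.single i 1) :=
    hψ1.continuous.mul ((hχ1.continuous_fderiv one_ne_zero).clm_apply continuous_const)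
  have hc2 : Continuous fun z => χ z * fderiv ℝ ψ z (EuclideanSpace.single i 1) :=
    hχ1.continuous.mul ((hψ1.continuous_fderiv one_ne_zero).clm_apply continuous_const)
  have hs1 : HasCompactSupport fun z => ψ z * fderiv ℝ χ z (EuclideanSpace.single i 1) :=
    hψc.mul_right
  have hs2 : HasCompactSupport fun z => χ z * fderiv ℝ ψ z (EuclideanSpace.single i 1) :=
    (hψc.fderiv ℝ).mono fun z hz h0 => hz (by simp [h0])
  have hi1 := hmul hu1 hc1 hs1
  have hi2 := hmul hu1 hc2 hs2
  have hi3 : Integrable (fun z => G z i * (ψ z * χ z)) (volumeOn Ω) :=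
    hmul hG1 (hψ1.continuous.mul hχ1.continuous) hψχc
  simp only [hd, mul_add] at hw
  rw [integral_add hi1 hi2] at hw
  have hl : ∫ z in Ω, ψ z * u z * fderiv ℝ χ z (EuclideanSpace.single i 1) =
      ∫ z, u z * (ψ z * fderiv ℝ χ z (EuclideanSpace.single i 1)) ∂(volumeOn Ω) :=
    integral_congr_ae (ae_of_all _ fun z => by simp only; ring)
  have hr : ∫ z in Ω, (ψ z • G z + u z • gradient ψ z) i * χ z =
      (∫ z, G z i * (ψ z * χ z) ∂(volumeOn Ω)) +
        ∫ z, u z * (χ z * fderiv ℝ ψ z (EuclideanSpace.single i 1)) ∂(volumeOn Ω) := by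
    rw [← integral_add hi3 hi2]
    refine integral_congr_ae (ae_of_all _ fun z => ?_)
    simp only [PiLp.add_apply, PiLp.smul_apply, smul_eq_mul, gradient_apply_eq_fderiv]
    ring
  rw [hl, hr]
  linarith

/-- The part `ψ u` of a function `u ∈ H^1(Ω)` that is supported in a graph chart is a limit in
`H^1(Ω)` of smooth functions: convolution with bump functions that look upwards, into `Ω`. -/
lemma IsGraphChart.exists_approx (hΩ : IsBoundedSmoothDomain Ω) {x₀ : RN N} {r : ℝ} {e : RN N}
    {γ : RN N → ℝ} (h : IsGraphChart Ω x₀ r e γ) {u : RN N → ℝ} {G : RN N → RN N}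
    (hu : IsH1WithGradient Ω u G) {ψ : RN N → ℝ} (hψ : ContDiff ℝ ∞ ψ)
    (hψs : tsupport ψ ⊆ Metric.ball x₀ (r / 2)) :
    ∃ φ : ℕ → RN N → ℝ, (∀ k, ContDiff ℝ ∞ (φ k)) ∧
      Tendsto (fun k => eLpNorm (fun x => φ k x - ψ x * u x) 2 (volumeOn Ω)) atTop (𝓝 0) ∧
      Tendsto (fun k => eLpNorm
        (fun x => gradient (φ k) x - (ψ x • G x + u x • gradient ψ x)) 2 (volumeOn Ω))
        atTop (𝓝 0) := by
  have hψc := hasCompactSupport_of_tsupport_subset_ball hψs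
  have hψ1 : ContDiff ℝ 1 ψ := hψ.of_le (by exact_mod_cast le_top)
  have hgψ : Continuous (gradient ψ) :=
    (LinearIsometryEquiv.continuous _).comp (hψ1.continuous_fderiv one_ne_zero)
  obtain ⟨L, hL0, hL⟩ := h.exists_shift_mem
  set v : RN N → ℝ := Ω.indicator fun z => ψ z * u z
  set H : RN N → RN N := Ω.indicator fun z => ψ z • G z + u z • gradient ψ z
  obtain ⟨M₀, hM₀⟩ := hψc.exists_bound_of_continuous hψ1.continuous
  obtain ⟨M₁, hM₁⟩ := (hψc.fderiv ℝ).exists_bound_of_continuous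
    (hψ1.continuous_fderiv one_ne_zero)
  have hum := hu.memLp.aestronglyMeasurable
  have hGm := hu.memLp_gradient.aestronglyMeasurable
  have hv : MemLp v 2 (volume : Measure (RN N)) := by
    refine (memLp_indicator_iff_restrict hΩ.isOpen.measurableSet).2 ?_
    refine hu.memLp.of_le_mul (c := M₀) (hψ1.continuous.aestronglyMeasurable.mul hum)
      (ae_of_all _ fun z => ?_)
    rw [norm_mul]
    exact mul_le_mul_of_nonneg_right (hM₀ z) (norm_nonneg _)
  have hH : MemLp H 2 (volume : Measure (RN N)) := by
    refine (memLp_indicator_iff_restrict hΩ.isOpen.measurableSet).2 (MemLp.add ?_ ?_)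
    · refine hu.memLp_gradient.of_le_mul (c := M₀)
        (hψ1.continuous.aestronglyMeasurable.smul hGm) (ae_of_all _ fun z => ?_)
      rw [norm_smul]
      exact mul_le_mul_of_nonneg_right (hM₀ z) (norm_nonneg _)
    · refine hu.memLp.of_le_mul (c := M₁) (hum.smul hgψ.aestronglyMeasurable)
        (ae_of_all _ fun z => ?_)
      rw [norm_smul, mul_comm, norm_gradient]
      exact mul_le_mul_of_nonneg_right (hM₁ z) (norm_nonneg _)
  -- the radii of the bump functions; their centres are `-(L + 1) ε e`
  set ε : ℕ → ℝ := fun k => r / 2 / (L + 2) / (k + 1)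
  have hε : ∀ k, 0 < ε k := fun k => by have := h.r_pos; positivity
  have hεr : ∀ k, (L + 2) * ε k ≤ r / 2 := fun k => by
    have h1 : (L + 2) * ε k = r / 2 / (k + 1) := by
      simp only [ε]
      field_simp
    rw [h1]
    exact div_le_self (half_pos h.r_pos).le (by linarith [(Nat.cast_nonneg k : (0 : ℝ) ≤ k)])
  set b : ∀ k, ContDiffBump (-(((L + 1) * ε k) • e)) := fun k =>
    ⟨ε k / 2, ε k, half_pos (hε k), half_lt_self (hε k)⟩
  set K : ℕ → RN N → ℝ := fun k => (b k).normed volume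
  have hKd : ∀ k, ContDiff ℝ ∞ (K k) := fun k => (b k).contDiff_normed
  have hKd1 : ∀ k, ContDiff ℝ 1 (K k) := fun k => (hKd k).of_le (by exact_mod_cast le_top)
  have hKs : ∀ k, HasCompactSupport (K k) := fun k => (b k).hasCompactSupport_normed
  have hKR : ∀ k z, K k z ≠ 0 → ‖z‖ < (L + 2) * ε k := by
    intro k z hz
    have hmem : z ∈ Function.support (K k) := hz
    rw [(b k).support_normed_eq, mem_ball_iff_norm] at hmem
    have h1 := norm_sub_le (z - -(((L + 1) * ε k) • e)) (((L + 1) * ε k) • e)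
    have hpos : 0 ≤ (L + 1) * ε k := mul_nonneg (by linarith) (hε k).le
    rw [norm_smul, h.norm_eq, mul_one, Real.norm_of_nonneg hpos, sub_neg_eq_add,
      add_sub_cancel_right] at h1
    rw [sub_neg_eq_add] at hmem
    have h2 : (b k).rOut = ε k := rfl
    rw [h2] at hmem
    linarith
  have hRlim : Tendsto (fun k => (L + 2) * ε k) atTop (𝓝 0) := by
    have h1 : Tendsto ε atTop (𝓝 0) := by
      have := (tendsto_one_div_add_atTop_nhds_zero_nat (𝕜 := ℝ)).const_mul (r / 2 / (L + 2))
      simpa [ε, div_eq_mul_inv] using this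
    simpa using h1.const_mul (L + 2)
  have hvl : LocallyIntegrable v := hv.locallyIntegrable one_le_two
  have hHl : LocallyIntegrable H := hH.locallyIntegrable one_le_two
  have hgrad : ∀ k, ∀ x ∈ Ω, gradient (K k ⋆[ContinuousLinearMap.lsmul ℝ ℝ, volume] v) x =
      (K k ⋆[ContinuousLinearMap.lsmul ℝ ℝ, volume] H) x := by
    intro k x hx
    refine gradient_convolution (hKd1 k) (hKs k) hvl hHl fun i => ?_
    have hχ : ContDiff ℝ ∞ fun z => K k (x - z) := (hKd k).comp (contDiff_const.sub contDiff_id)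
    have hsub : tsupport ψ ∩ tsupport (fun z => K k (x - z)) ⊆ Ω := by
      rintro w ⟨hw1, hw2⟩
      have hw3 : x - w ∈ tsupport (K k) := by
        have := tsupport_comp_subset_preimage (K k) (f := fun z => x - z) (by fun_prop) hw2
        exact this
      rw [(b k).tsupport_normed_eq, mem_closedBall_iff_norm] at hw3
      refine hL (ε k) (hε k) (hεr k) x hx w (hψs hw1) ?_
      have hneg : x - w - -(((L + 1) * ε k) • e) = -(w - (x + ((L + 1) * ε k) • e)) := by abel
      rwa [hneg, norm_neg] at hw3
    have hw := hu.weak_gradient_mul hΩ hψ hχ hψc hsub i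
    have e1 : ∀ z, v z * fderiv ℝ (fun z => K k (x - z)) z (EuclideanSpace.single i 1) =
        Ω.indicator (fun z => ψ z * u z *
          fderiv ℝ (fun z => K k (x - z)) z (EuclideanSpace.single i 1)) z := fun z => by
      by_cases hz : z ∈ Ω <;> simp [v, hz]
    have e2 : ∀ z, H z i * K k (x - z) =
        Ω.indicator (fun z => (ψ z • G z + u z • gradient ψ z) i * K k (x - z)) z := fun z => by
      by_cases hz : z ∈ Ω <;> simp [H, hz]
    simp only [e1, e2]
    rw [integral_indicator hΩ.isOpen.measurableSet, integral_indicator hΩ.isOpen.measurableSet]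
    exact hw
  have hlim : ∀ {F : Type} [NormedAddCommGroup F] [NormedSpace ℝ F] [CompleteSpace F]
      {f : RN N → F}, MemLp f 2 (volume : Measure (RN N)) → Tendsto (fun k => eLpNorm
        (fun x => (K k ⋆[ContinuousLinearMap.lsmul ℝ ℝ, volume] f) x - f x) 2 (volumeOn Ω))
        atTop (𝓝 0) := by
    intro F _ _ _ f hf
    refine tendsto_of_tendsto_of_tendsto_of_le_of_le tendsto_const_nhds
      (tendsto_eLpNorm_convolution_sub (fun k => (hKd1 k).continuous) hKs
        (fun k => (b k).nonneg_normed) (fun k => (b k).integral_normed) hRlim hKR hf)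
      (fun _ => zero_le) fun k => eLpNorm_mono_measure _ Measure.restrict_le_self
  have hae : ∀ {F : Type} [NormedAddCommGroup F] {f g : RN N → F}, (∀ x ∈ Ω, f x = g x) →
      eLpNorm f 2 (volumeOn Ω) = eLpNorm g 2 (volumeOn Ω) := fun hfg =>
    eLpNorm_congr_ae ((ae_restrict_iff' hΩ.isOpen.measurableSet).2 (ae_of_all _ hfg))
  refine ⟨fun k => K k ⋆[ContinuousLinearMap.lsmul ℝ ℝ, volume] v,
    fun k => (hKs k).contDiff_convolution_left _ (hKd k) hvl,
    (hlim hv).congr fun k => hae fun x hx => ?_, (hlim hH).congr fun k => hae fun x hx => ?_⟩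
  · simp only [v, indicator_of_mem hx]
  · rw [hgrad k x hx]
    simp only [H, indicator_of_mem hx]

end Density

/-! ### Traces and the inequality in `H^1` -/

section Trace

variable {N : ℕ} {Ω : Set (RN N)}

/-- Functions that are smooth on all of `ℝ^N` are dense in `H^1(Ω)`. -/
lemma IsH1WithGradient.exists_approx (hN : 1 ≤ N) (hΩ : IsBoundedSmoothDomain Ω)
    {u : RN N → ℝ} {G : RN N → RN N} (hu : IsH1WithGradient Ω u G) :
    ∃ φ : ℕ → RN N → ℝ, (∀ k, ContDiff ℝ ∞ (φ k)) ∧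
      Tendsto (fun k => eLpNorm (fun x => φ k x - u x) 2 (volumeOn Ω)) atTop (𝓝 0) ∧
      Tendsto (fun k => eLpNorm (fun x => gradient (φ k) x - G x) 2 (volumeOn Ω))
        atTop (𝓝 0) := by
  obtain ⟨t, r, e, γ, ψ, hchart, hψ, hψ0, hψs, hψ1⟩ := hΩ.exists_partition hN
  have h : ∀ i, ∃ φ : ℕ → RN N → ℝ, i ∈ t → (∀ k, ContDiff ℝ ∞ (φ k)) ∧
      Tendsto (fun k => eLpNorm (fun x => φ k x - ψ i x * u x) 2 (volumeOn Ω)) atTop (𝓝 0) ∧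
      Tendsto (fun k => eLpNorm
        (fun x => gradient (φ k) x - (ψ i x • G x + u x • gradient (ψ i) x)) 2 (volumeOn Ω))
        atTop (𝓝 0) := by
    intro i
    by_cases hi : i ∈ t
    · obtain ⟨φ, hφ⟩ := (hchart i hi).exists_approx hΩ hu (hψ i) (hψs i hi)
      exact ⟨φ, fun _ => hφ⟩
    · exact ⟨0, fun h => absurd h hi⟩
  choose φ hφ using h
  have hone : (∞ : WithTop ℕ∞) ≠ 0 := by simp
  have hgc : ∀ {f : RN N → ℝ}, ContDiff ℝ ∞ f → Continuous (gradient f) := fun hf =>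
    (LinearIsometryEquiv.continuous _).comp (hf.continuous_fderiv hone)
  have hum := hu.memLp.aestronglyMeasurable
  have hGm := hu.memLp_gradient.aestronglyMeasurable
  have hzero : ∀ {F : Type} [NormedAddCommGroup F] (f : RN N → ℕ → RN N → F)
      (g : ℕ → RN N → F), (∀ i ∈ t, ∀ k, AEStronglyMeasurable (f i k) (volumeOn Ω)) →
      (∀ i ∈ t, Tendsto (fun k => eLpNorm (f i k) 2 (volumeOn Ω)) atTop (𝓝 0)) →
      (∀ k, ∀ x ∈ Ω, g k x = ∑ i ∈ t, f i k x) →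
      Tendsto (fun k => eLpNorm (g k) 2 (volumeOn Ω)) atTop (𝓝 0) := by
    intro F _ f g hm hf hg
    have hs := tendsto_finsetSum t hf
    rw [Finset.sum_const_zero] at hs
    refine tendsto_of_tendsto_of_tendsto_of_le_of_le tendsto_const_nhds hs
      (fun _ => zero_le) fun k => ?_
    have h1 : eLpNorm (g k) 2 (volumeOn Ω) = eLpNorm (∑ i ∈ t, f i k) 2 (volumeOn Ω) := by
      refine eLpNorm_congr_ae ((ae_restrict_iff' hΩ.isOpen.measurableSet).2
        (ae_of_all _ fun x hx => ?_))
      rw [hg k x hx, Finset.sum_apply]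
    dsimp only
    rw [h1]
    exact eLpNorm_sum_le (fun i hi => hm i hi k) one_le_two
  refine ⟨fun k x => ∑ i ∈ t, φ i k x, fun k => ContDiff.sum fun i hi => (hφ i hi).1 k,
    hzero (fun i k x => φ i k x - ψ i x * u x) _ (fun i hi k => ?_)
      (fun i hi => (hφ i hi).2.1) fun k x hx => ?_,
    hzero (fun i k x => gradient (φ i k) x - (ψ i x • G x + u x • gradient (ψ i) x)) _
      (fun i hi k => ?_) (fun i hi => (hφ i hi).2.2) fun k x hx => ?_⟩
  · exact ((hφ i hi).1 k).continuous.aestronglyMeasurable.sub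
      ((hψ i).continuous.aestronglyMeasurable.mul hum)
  · rw [Finset.sum_sub_distrib, ← Finset.sum_mul, hψ1 x (subset_closure hx), one_mul]
  · exact (hgc ((hφ i hi).1 k)).aestronglyMeasurable.sub
      (((hψ i).continuous.aestronglyMeasurable.smul hGm).add
        (hum.smul (hgc (hψ i)).aestronglyMeasurable))
  · -- the gradients of the partition of unity cancel
    have hgrad : ∀ f : RN N → RN N → ℝ, (∀ i ∈ t, ContDiff ℝ ∞ (f i)) →
        gradient (fun x => ∑ i ∈ t, f i x) x = ∑ i ∈ t, gradient (f i) x := by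
      intro f hf
      have h1 : HasFDerivAt (fun x => ∑ i ∈ t, f i x) (∑ i ∈ t, fderiv ℝ (f i) x) x :=
        HasFDerivAt.fun_sum fun i hi => ((hf i hi).differentiable hone x).hasFDerivAt
      rw [gradient, h1.fderiv, map_sum]
      rfl
    have hψg : ∑ i ∈ t, gradient (ψ i) x = 0 := by
      rw [← hgrad ψ fun i _ => hψ i, gradient]
      have h1 : (fun y => ∑ i ∈ t, ψ i y) =ᶠ[𝓝 x] fun _ => (1 : ℝ) := by
        filter_upwards [hΩ.isOpen.mem_nhds hx] with y hy using hψ1 y (subset_closure hy)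
      rw [h1.fderiv_eq]
      simp
    rw [hgrad _ fun i hi => (hφ i hi).1 k, Finset.sum_sub_distrib, Finset.sum_add_distrib,
      ← Finset.sum_smul, ← Finset.smul_sum, hψ1 x (subset_closure hx), hψg]
    simp

lemma enorm_sq_eq_ofReal {F : Type*} [NormedAddCommGroup F] (x : F) :
    ‖x‖ₑ ^ 2 = ENNReal.ofReal (‖x‖ ^ 2) := by
  rw [← ofReal_norm, ENNReal.ofReal_pow (norm_nonneg _)]

/-- The trace inequality in terms of `L^2` norms. -/
lemma IsBoundedSmoothDomain.exists_eLpNorm_trace_le (hN : 1 ≤ N) (hΩ : IsBoundedSmoothDomain Ω) :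
    ∃ C : NNReal, ∀ φ : RN N → ℝ, ContDiff ℝ 1 φ →
      eLpNorm φ 2 (surfaceMeasure Ω) ^ 2 ≤
        C * (eLpNorm φ 2 (volumeOn Ω) ^ 2 + eLpNorm (gradient φ) 2 (volumeOn Ω) ^ 2) := by
  obtain ⟨C, hC⟩ := hΩ.exists_trace_inequality hN
  refine ⟨C, fun φ hφ => ?_⟩
  have h := hC φ hφ
  simp only [eLpNorm_two_sq, enorm_sq_eq_ofReal, norm_gradient, Real.norm_eq_abs, sq_abs]
  have hm : Measurable fun z => ENNReal.ofReal (φ z ^ 2) :=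
    (hφ.continuous.pow 2).measurable.ennreal_ofReal
  rw [← lintegral_add_left hm]
  refine h.trans (le_of_eq ?_)
  congr 1
  exact lintegral_congr fun z => ENNReal.ofReal_add (sq_nonneg _) (sq_nonneg _)

lemma IsBoundedSmoothDomain.memLp_surfaceMeasure (hN : 1 ≤ N) (hΩ : IsBoundedSmoothDomain Ω)
    {φ : RN N → ℝ} (hφ : ContDiff ℝ 1 φ) : MemLp φ 2 (surfaceMeasure Ω) := by
  refine ⟨hφ.continuous.aestronglyMeasurable, ?_⟩
  have h := hΩ.lintegral_trace_lt_top hN hφ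
  have h2 : eLpNorm φ 2 (surfaceMeasure Ω) ^ 2 < ⊤ := by
    rw [eLpNorm_two_sq]
    simpa only [enorm_sq_eq_ofReal, Real.norm_eq_abs, sq_abs] using h
  by_contra hcon
  rw [not_lt_top_iff.1 hcon] at h2
  simp at h2

/-- Every function in `H^1(Ω)` has a trace: by the trace inequality, approximating smooth functions
restrict to a Cauchy sequence on the boundary. -/
lemma IsH1WithGradient.exists_isTrace (hN : 1 ≤ N) (hΩ : IsBoundedSmoothDomain Ω)
    {u : RN N → ℝ} {G : RN N → RN N} (hu : IsH1WithGradient Ω u G) :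
    ∃ g : RN N → ℝ, IsTrace Ω u g := by
  obtain ⟨φ, hφ, hφu, hφG⟩ := hu.exists_approx hN hΩ
  have hφ1 : ∀ k, ContDiff ℝ 1 (φ k) := fun k => (hφ k).of_le (by exact_mod_cast le_top)
  obtain ⟨C, hC⟩ := hΩ.exists_eLpNorm_trace_le hN
  have hmem : ∀ k, MemLp (φ k) 2 (surfaceMeasure Ω) := fun k =>
    hΩ.memLp_surfaceMeasure hN (hφ1 k)
  have : Fact ((1 : ℝ≥0∞) ≤ 2) := ⟨one_le_two⟩
  set a : ℕ → ℝ≥0∞ := fun k => eLpNorm (fun x => φ k x - u x) 2 (volumeOn Ω)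
  set b : ℕ → ℝ≥0∞ := fun k => eLpNorm (fun x => gradient (φ k) x - G x) 2 (volumeOn Ω)
  have hum := hu.memLp.aestronglyMeasurable
  have hGm := hu.memLp_gradient.aestronglyMeasurable
  have hgm : ∀ k, AEStronglyMeasurable (gradient (φ k)) (volumeOn Ω) := fun k =>
    ((LinearIsometryEquiv.continuous _).comp
      ((hφ1 k).continuous_fderiv one_ne_zero)).aestronglyMeasurable
  have hbound : ∀ k l, eLpNorm (φ k - φ l) 2 (surfaceMeasure Ω) ^ 2 ≤
      C * ((a k + a l) ^ 2 + (b k + b l) ^ 2) := by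
    intro k l
    refine (hC (φ k - φ l) ((hφ1 k).sub (hφ1 l))).trans (mul_le_mul_right ?_ _)
    refine add_le_add (pow_le_pow_left' ?_ 2) (pow_le_pow_left' ?_ 2)
    · have h1 : φ k - φ l = (fun x => φ k x - u x) - fun x => φ l x - u x := by
        ext x
        simp
      rw [h1]
      exact eLpNorm_sub_le ((hφ k).continuous.aestronglyMeasurable.sub hum)
        ((hφ l).continuous.aestronglyMeasurable.sub hum) one_le_two
    · have h1 : gradient (φ k - φ l) =
          (fun x => gradient (φ k) x - G x) - fun x => gradient (φ l) x - G x := by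
        ext1 x
        have h2 := ((hφ1 k).differentiable one_ne_zero x).hasFDerivAt.sub
          ((hφ1 l).differentiable one_ne_zero x).hasFDerivAt
        rw [gradient, h2.fderiv, map_sub, Pi.sub_apply, sub_sub_sub_cancel_right]
        rfl
      rw [h1]
      exact eLpNorm_sub_le ((hgm k).sub hGm) ((hgm l).sub hGm) one_le_two
  have hlim : Tendsto (fun p : ℕ × ℕ => (C : ℝ≥0∞) * ((a p.1 + a p.2) ^ 2 + (b p.1 + b p.2) ^ 2))
      atTop (𝓝 0) := by
    rw [← prod_atTop_atTop_eq]
    have ha : Tendsto (fun p : ℕ × ℕ => (a p.1 + a p.2) ^ 2) (atTop ×ˢ atTop) (𝓝 ((0 + 0) ^ 2)) :=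
      ((ENNReal.continuous_pow 2).tendsto _).comp
        ((hφu.comp tendsto_fst).add (hφu.comp tendsto_snd))
    have hb : Tendsto (fun p : ℕ × ℕ => (b p.1 + b p.2) ^ 2) (atTop ×ˢ atTop) (𝓝 ((0 + 0) ^ 2)) :=
      ((ENNReal.continuous_pow 2).tendsto _).comp
        ((hφG.comp tendsto_fst).add (hφG.comp tendsto_snd))
    have := ENNReal.Tendsto.const_mul (a := (C : ℝ≥0∞)) (ha.add hb) (Or.inr ENNReal.coe_ne_top)
    simpa using this
  have hcauchy : CauchySeq fun k => (hmem k).toLp (φ k) := by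
    rw [EMetric.cauchySeq_iff]
    intro ε hε
    have hev := hlim.eventually (gt_mem_nhds (show (0 : ℝ≥0∞) < ε ^ 2 by positivity))
    obtain ⟨⟨n₁, n₂⟩, hn⟩ := eventually_atTop.1 hev
    refine ⟨max n₁ n₂, fun k hk l hl => ?_⟩
    rw [Lp.edist_toLp_toLp]
    refine lt_of_not_ge fun hle => (pow_le_pow_left' hle 2).not_gt ((hbound k l).trans_lt ?_)
    exact hn (k, l) ⟨(le_max_left _ _).trans hk, (le_max_right _ _).trans hl⟩
  obtain ⟨g, hg⟩ := cauchySeq_tendsto_of_complete hcauchy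
  refine ⟨g, Lp.memLp g, G, hu, φ, hφ, hφu, hφG, ?_⟩
  have h1 := (tendsto_iff_edist_tendsto_0.1 hg)
  refine h1.congr fun k => ?_
  conv_lhs => rw [← Lp.toLp_coeFn g (Lp.memLp g)]
  rw [Lp.edist_toLp_toLp]
  rfl

/-- Weak gradients are unique. -/
lemma IsH1WithGradient.gradient_ae_eq (hΩ : IsBoundedSmoothDomain Ω) {u : RN N → ℝ}
    {G G' : RN N → RN N} (hu : IsH1WithGradient Ω u G) (hu' : IsH1WithGradient Ω u G') :
    G =ᵐ[volumeOn Ω] G' := by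
  have hfin : IsFiniteMeasure (volumeOn Ω) :=
    isFiniteMeasure_restrict.2 hΩ.isBounded.measure_lt_top.ne
  have hint : ∀ {G : RN N → RN N}, IsH1WithGradient Ω u G → ∀ i : Fin N,
      Integrable (fun z => G z i) (volumeOn Ω) := fun h i =>
    (EuclideanSpace.proj i : RN N →L[ℝ] ℝ).integrable_comp
      (h.memLp_gradient.integrable one_le_two)
  have hi : ∀ i : Fin N, ∀ᵐ x, x ∈ Ω → G x i - G' x i = 0 := by
    intro i
    have hl : IntegrableOn (fun x => G x i - G' x i) Ω := (hint hu i).sub (hint hu' i)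
    refine hΩ.isOpen.ae_eq_zero_of_integral_contDiff_smul_eq_zero hl.locallyIntegrableOn
      fun ψ hψ hψc hψs => ?_
    have h1 := hu.weak_gradient ψ hψ hψc hψs i
    have h2 := hu'.weak_gradient ψ hψ hψc hψs i
    have h3 : ∫ x, G x i * ψ x ∂(volumeOn Ω) = ∫ x, G' x i * ψ x ∂(volumeOn Ω) := by
      linarith
    obtain ⟨M, hM⟩ := hψc.exists_bound_of_continuous hψ.continuous
    have hm : ∀ {G : RN N → RN N}, IsH1WithGradient Ω u G →
        Integrable (fun z => G z i * ψ z) (volumeOn Ω) := fun h =>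
      (hint h i).mul_bdd hψ.continuous.aestronglyMeasurable (ae_of_all _ hM)
    rw [← setIntegral_eq_integral_of_forall_compl_eq_zero (s := Ω)]
    · have h4 : ∫ x in Ω, ψ x • (G x i - G' x i) =
          ∫ x, (G x i * ψ x - G' x i * ψ x) ∂(volumeOn Ω) :=
        integral_congr_ae (ae_of_all _ fun x => by simp only [smul_eq_mul]; ring)
      rw [h4, integral_sub (hm hu) (hm hu'), h3, sub_self]
    · intro x hx
      rw [image_eq_zero_of_notMem_tsupport fun hc => hx (hψs hc), zero_smul]
  rw [Filter.EventuallyEq, volumeOn, ae_restrict_iff' hΩ.isOpen.measurableSet]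
  filter_upwards [ae_all_iff.2 hi] with x hx hxΩ
  ext i
  exact sub_eq_zero.1 (hx i hxΩ)

lemma tendsto_integral_norm_sq {F : Type*} [NormedAddCommGroup F] {μ : Measure (RN N)}
    {f : ℕ → RN N → F} {g : RN N → F} (hf : ∀ k, MemLp (f k) 2 μ) (hg : MemLp g 2 μ)
    (h : Tendsto (fun k => eLpNorm (fun x => f k x - g x) 2 μ) atTop (𝓝 0)) :
    Tendsto (fun k => ∫ x, ‖f k x‖ ^ 2 ∂μ) atTop (𝓝 (∫ x, ‖g x‖ ^ 2 ∂μ)) := by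
  have : Fact ((1 : ℝ≥0∞) ≤ 2) := ⟨one_le_two⟩
  have hlim : Tendsto (fun k => (hf k).toLp (f k)) atTop (𝓝 (hg.toLp g)) := by
    rw [tendsto_iff_edist_tendsto_0]
    simp only [Lp.edist_toLp_toLp]
    exact h
  have hnorm : ∀ {f : RN N → F} (hf : MemLp f 2 μ), ‖hf.toLp f‖ ^ 2 = ∫ x, ‖f x‖ ^ 2 ∂μ := by
    intro f hf
    rw [Lp.norm_toLp, ← ENNReal.toReal_pow, eLpNorm_two_sq, integral_eq_lintegral_of_nonneg_ae
      (ae_of_all _ fun x => sq_nonneg _) (hf.aestronglyMeasurable.norm.pow 2)]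
    simp only [enorm_sq_eq_ofReal]
  have := hlim.norm.pow 2
  simpa only [hnorm] using this

/-- The Poincaré-type inequality in `H^1(Ω)`, by density. -/
lemma IsBoundedSmoothDomain.poincareTypeInequality (hN : 1 ≤ N) (hΩ : IsBoundedSmoothDomain Ω) :
    PoincareTypeInequality Ω (N / Metric.diam Ω) := by
  rintro u G g hu ⟨hg, G', hu', φ, hφ, hφu, hφG, hφg⟩ δ hδ
  have hφ1 : ∀ k, ContDiff ℝ 1 (φ k) := fun k => (hφ k).of_le (by exact_mod_cast le_top)
  have hfin : IsFiniteMeasure (volumeOn Ω) :=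
    isFiniteMeasure_restrict.2 hΩ.isBounded.measure_lt_top.ne
  have hcont : ∀ {F : Type} [NormedAddCommGroup F] [SecondCountableTopology F] {f : RN N → F},
      Continuous f → MemLp f 2 (volumeOn Ω) := by
    intro F _ _ f hf
    obtain ⟨M, hM⟩ := hΩ.isBounded.isCompact_closure.exists_bound_of_continuousOn hf.continuousOn
    exact MemLp.of_bound hf.aestronglyMeasurable M ((ae_restrict_iff' hΩ.isOpen.measurableSet).2
      (ae_of_all _ fun x hx => hM x (subset_closure hx)))
  have hG : ∫ x, ‖G x‖ ^ 2 ∂(volumeOn Ω) = ∫ x, ‖G' x‖ ^ 2 ∂(volumeOn Ω) := by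
    refine integral_congr_ae ?_
    filter_upwards [hu.gradient_ae_eq hΩ hu'] with x hx
    rw [hx]
  have l1 := tendsto_integral_norm_sq (fun k => hcont (hφ1 k).continuous) hu.memLp hφu
  have l2 := tendsto_integral_norm_sq (fun k => hcont ((LinearIsometryEquiv.continuous _).comp
    ((hφ1 k).continuous_fderiv one_ne_zero))) hu'.memLp_gradient hφG
  have l3 := tendsto_integral_norm_sq (fun k => hΩ.memLp_surfaceMeasure hN (hφ1 k)) hg hφg
  simp only [Real.norm_eq_abs, sq_abs] at l1 l3
  rw [hG]
  refine le_of_tendsto_of_tendsto' (l1.const_mul _) (l2.add (l3.const_mul δ)) fun k => ?_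
  have := hΩ.poincare_of_contDiff hN (hφ1 k) hδ
  simp only [← norm_gradient] at this
  exact this

end Trace

theorem lemma2p1 {N : ℕ} (hN : 1 ≤ N) (Ω : Set (RN N)) (hΩ : IsBoundedSmoothDomain Ω) :
    -- every `u ∈ H^1(Ω)` has a boundary trace
    (∀ (u : RN N → ℝ) (G : RN N → RN N), IsH1WithGradient Ω u G →
      ∃ g : RN N → ℝ, IsTrace Ω u g) ∧
    -- the inequality holds with some positive constant
    (∃ c : ℝ, 0 < c ∧ PoincareTypeInequality Ω c) ∧
    -- and the constant can be taken to be `N / diam Ω`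
    (0 < (N : ℝ) / Metric.diam Ω ∧ PoincareTypeInequality Ω ((N : ℝ) / Metric.diam Ω)) := by
  have hpos : 0 < (N : ℝ) / Metric.diam Ω := div_pos (by exact_mod_cast hN) (hΩ.diam_pos hN)
  have hineq := hΩ.poincareTypeInequality hN
  exact ⟨fun u G hu => hu.exists_isTrace hN hΩ, ⟨_, hpos, hineq⟩, hpos, hineq⟩
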